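/- Let $X$ be a complex Banach space. Let $\mathbb T^\infty$ be the countable product of the unit circle $\mathbb T\subset\mathbb C$, with the product $dz$ of the normalized Lebesgue measures. For a finitely supported sequence $\alpha=(\alpha_1,\alpha_2,\dots)$ of integers put $z^\alpha=\prod_j z_j^{\alpha_j}$, and $|\alpha|=\sum_j\alpha_j$ if all $\alpha_j\ge 0$; write $\mathbb N_0^{(\mathbb N)}$ and $\mathbb Z^{(\mathbb N)}$ for the sets of finitely supported sequences in $\mathbb N_0$ and $\mathbb Z$. Let $1\le q\le\infty$ and $\frac1q+\frac1{q'}=1$. Suppose that $X$ has hypercontractive homogeneous cotype $q$, that is, there is a constant $C>0$ such that for every $m\in\mathbb N$ and every family $(x_\alpha)_{\alpha\in\mathbb N_0^{(\mathbb N)},\,|\alpha|=m}$ in $X$ with only finitely many non-zero elements $$\Big(\sum_{|\alpha|=m}\|x_\alpha\|^q\Big)^{1/q}\le C^m\Big(\int_{\mathbb T^\infty}\Big\|\sum_{|\alpha|=m}x_\alpha z^\alpha\Big\|^2\,dz\Big)^{1/2}$$ (for $q=\infty$ the left-hand side is $\sup_{|\alpha|=m}\|x_\alpha\|$). Then $$\ell_{q'}\cap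 B_{c_0}\subset \operatorname{mon}H_1(\mathbb T^\infty,X).$$ Here $B_{c_0}$ is the open unit ball of $c_0$, i.e. the set of complex sequences $z=(z_n)$ with $z_n\to 0$ and $\sup_n|z_n|<1$; $H_1(\mathbb T^\infty,X)$ is the space of all $f\in L_1(\mathbb T^\infty,X)$ whose Fourier coefficients $\hat f(\alpha)=\int_{\mathbb T^\infty}f(z)z^{-\alpha}\,dz$ vanish for all $\alpha\in\mathbb Z^{(\mathbb N)}\setminus\mathbb N_0^{(\mathbb N)}$; and $\operatorname{mon}H_1(\mathbb T^\infty,X)$ is the set of all $z\in\mathbb C^{\mathbb N}$ such that $\sum_{\alpha\in\mathbb N_0^{(\mathbb N)}}\|\hat f(\alpha)z^\alpha\|_X<\infty$ for all $f\in H_1(\mathbb T^\infty,X)$. -/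

import Mathlib

open MeasureTheory Filter Topology
open scoped ENNReal

noncomputable section

namespace MonConv

/-- The infinite-dimensional torus `𝕋^∞`, as the countable power of `ℝ / ℤ`; the point `t`
stands for the sequence of unimodular numbers `(exp (2 π i t_j))_j`, see `coord`. -/
abbrev InfTorus : Type := ℕ → UnitAddCircle

/-- The countable product of the normalized Lebesgue measure on the circle. -/
def torusMeasure : Measure InfTorus :=
  Measure.infinitePi fun _ : ℕ => (AddCircle.haarAddCircle : Measure UnitAddCircle)

/-- The unimodular complex coordinates `z_j = exp (2 π i t_j)` of a point of the torus. -/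
def coord (t : InfTorus) : ℕ → ℂ := fun j => (AddCircle.toCircle (t j) : ℂ)

/-- The monomial `z ^ α` for a multi-index with nonnegative entries. -/
def monomial (z : ℕ → ℂ) (α : ℕ →₀ ℕ) : ℂ := α.prod fun j k => z j ^ k

/-- The monomial `z ^ α` for a multi-index with integer entries. -/
def zMonomial (z : ℕ → ℂ) (α : ℕ →₀ ℤ) : ℂ := α.prod fun j k => z j ^ k

/-- A multi-index with nonnegative entries regarded as one with integer entries. -/
def toIntIndex (α : ℕ →₀ ℕ) : ℕ →₀ ℤ := α.mapRange (fun k : ℕ => (k : ℤ)) Nat.cast_zero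

variable (X : Type*) [NormedAddCommGroup X] [NormedSpace ℂ X]

/-- Hypercontractive homogeneous cotype `q`: for some `C > 0`, every `m ≥ 1` and every finite
family `(x_α)_{|α| = m}` in `X`, the `ℓ_q` norm of the family is at most `C ^ m` times the
`L_2` norm of `∑ x_α z ^ α`. The norm on `PiLp q` is the `ℓ_q` norm of the family (the supremum
for `q = ∞`). -/
def HypercontractiveHomogeneousCotype (q : ℝ≥0∞) : Prop :=
  ∃ C : ℝ, 0 < C ∧ ∀ m : ℕ, 1 ≤ m → ∀ S : Finset (ℕ →₀ ℕ), (∀ α ∈ S, α.degree = m) →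
    ∀ x : (ℕ →₀ ℕ) → X,
      ‖(WithLp.toLp q fun α : S => x α : PiLp q fun _ : S => X)‖ ≤
        C ^ m * (∫ t, ‖∑ α ∈ S, monomial (coord t) α • x α‖ ^ 2 ∂torusMeasure) ^ (1 / 2 : ℝ)

variable {X}

/-- The Fourier coefficient `∫ f(z) z ^ (-α) dz`. -/
def torusFourierCoeff (f : InfTorus → X) (α : ℕ →₀ ℤ) : X :=
  ∫ t, zMonomial (coord t) (-α) • f t ∂torusMeasure

variable (X)

/-- The Hardy space `H_p(𝕋^∞, X)`, `1 ≤ p ≤ ∞`: the `f ∈ L_p(𝕋^∞, X)` whose Fourier coefficients vanish at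
every multi-index with a negative entry. -/
def hardySpace (p : ℝ≥0∞) : Set (Lp X p torusMeasure) :=
  {f | ∀ α : ℕ →₀ ℤ, (∃ j, α j < 0) → torusFourierCoeff (f : InfTorus → X) α = 0}

/-- The set of monomial convergence of `H_p(𝕋^∞, X)`. -/
def monHardy (p : ℝ≥0∞) : Set (ℕ → ℂ) :=
  {z | ∀ f ∈ hardySpace X p, Summable fun α : ℕ →₀ ℕ =>
    ‖monomial z α • torusFourierCoeff (f : InfTorus → X) (toIntIndex α)‖}

/-- The open unit ball of `c_0`, as a set of complex sequences. -/
def c0UnitBall : Set (ℕ → ℂ) := {z | Tendsto z atTop (𝓝 0) ∧ (⨆ n, ‖z n‖) < 1}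

/-- The space `ℓ_p`, as a set of complex sequences. -/
def ellSet (p : ℝ≥0∞) : Set (ℕ → ℂ) := {z | Memℓp z p}

end MonConv

end

/-!
The proof estimates `∑ ‖x_α z^α‖` by `K ∫ ‖P‖` for every analytic polynomial `P = ∑ x_α z^α`, with
`K` depending only on `z`, and passes from polynomials to `H_1`.

*From `H_1` to polynomials.* Convolution with the Fejér-type kernel `|∑_{β ∈ B} z^β|² / |B|`, for a
finite set `B` of multi-indices, does not increase the `L_1` norm and turns `f ∈ H_1` into an
analytic polynomial with coefficients `c_α f̂(α)`. For growing boxes `B` in finitely many variables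
the numbers `c_α` tend to `1`, so the estimate for polynomials bounds all finite partial sums of
`∑ ‖f̂(α) z^α‖` (`sum_norm_fourierCoeff_le`).

*Decomposition of a polynomial.* Let `k` be large, and collect the terms of `P` with prescribed
exponents in the first `k` variables and prescribed degree `m` in the others. The result is an
average of rotations of `P`, so its `L_1` norm is at most that of `P`
(`integral_norm_torusPoly_filter_le`). Up to a unimodular factor it is an `m`-homogeneous polynomial
in the variables beyond the `k`-th. On such a polynomial the cotype inequality, the comparison of
the `L_2` and `L_1` norms, and Hölder's inequality together give the factor `2 ^ (-m)`, because the
`ℓ_{q'}` norm of the family of all `m`-homogeneous monomials in the tail of `z` is at most the `m`-th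
power of the `ℓ_{q'}` norm of the tail, which is small. The remaining sum over the blocks is a
geometric series in `k + 1` variables with ratios `|z_j| < 1` and `1 / 2`.

*Comparison of norms.* For an `m`-homogeneous polynomial with values in any Banach space, the `L_2`
norm is at most `25 ^ m` times the `L_1` norm (`integral_sq_norm_torusPoly_le`). Convolution with a
tensor power of a truncated Poisson kernel multiplies the polynomial by `5 ^ (-m)`, and since the
kernel is positive, norms can be taken inside the integral. This reduces the matter to scalar
functions, for which the convolution is a contraction from `L_2` to `L_4`: in one variable because
the kernel is close to `1` (`IsHypercontractiveKernel.of_near_one`), in several variables by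
tensorization (`IsHypercontractiveKernel.prod`). Interpolating `L_2` between `L_1` and `L_4` then
yields the inequality.
-/

noncomputable section

namespace MonConv

/-! ### Characters of the infinite torus -/

instance : IsProbabilityMeasure torusMeasure := by
  unfold torusMeasure; infer_instance

instance : torusMeasure.IsAddLeftInvariant where
  map_add_left_eq_self s := by
    have h := Measure.infinitePi_map_pi
      (fun _ : ℕ => (AddCircle.haarAddCircle : Measure UnitAddCircle))
      (f := fun i x => s i + x) (fun i => measurable_const_add _)
    simp only [map_add_left_eq_self] at h
    exact h

instance : torusMeasure.IsAddRightInvariant where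
  map_add_right_eq_self s := by
    simpa only [add_comm] using map_add_left_eq_self torusMeasure s

/-- The character `t ↦ z ^ δ` of the infinite torus. -/
def chi (δ : ℕ →₀ ℤ) (t : InfTorus) : ℂ := zMonomial (coord t) δ

theorem coord_ne_zero (t : InfTorus) (j : ℕ) : coord t j ≠ 0 := by simp [coord]

theorem monomial_coord (t : InfTorus) (α : ℕ →₀ ℕ) :
    monomial (coord t) α = chi (toIntIndex α) t := by
  simp [monomial, chi, zMonomial, toIntIndex, Finsupp.prod_mapRange_index]

theorem toIntIndex_injective : Function.Injective toIntIndex :=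
  Finsupp.mapRange_injective _ Nat.cast_zero Nat.cast_injective

@[simp] theorem toIntIndex_apply (α : ℕ →₀ ℕ) (j : ℕ) : toIntIndex α j = α j := rfl

theorem toIntIndex_add (α β : ℕ →₀ ℕ) :
    toIntIndex (α + β) = toIntIndex α + toIntIndex β := by
  ext; simp

theorem chi_zero (t : InfTorus) : chi 0 t = 1 := by simp [chi, zMonomial]

theorem chi_add (δ ε : ℕ →₀ ℤ) (t : InfTorus) : chi (δ + ε) t = chi δ t * chi ε t :=
  Finsupp.prod_add_index' (by simp) fun j _ _ => zpow_add₀ (coord_ne_zero t j) _ _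

theorem chi_apply_add (δ : ℕ →₀ ℤ) (s t : InfTorus) : chi δ (s + t) = chi δ s * chi δ t := by
  simp [chi, zMonomial, coord, AddCircle.toCircle_add, mul_zpow, Finsupp.prod_mul]

theorem chi_neg (δ : ℕ →₀ ℤ) (t : InfTorus) : chi (-δ) t = (chi δ t)⁻¹ := by
  apply eq_inv_of_mul_eq_one_left
  rw [← chi_add, neg_add_cancel, chi_zero]

theorem chi_apply_zero (δ : ℕ →₀ ℤ) : chi δ 0 = 1 := by
  simp [chi, zMonomial, coord]

theorem norm_chi (δ : ℕ →₀ ℤ) (t : InfTorus) : ‖chi δ t‖ = 1 := by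
  simp only [chi, zMonomial, coord, Finsupp.prod, norm_prod, norm_zpow, Circle.norm_coe, one_zpow,
    Finset.prod_const_one]

theorem chi_apply_neg (δ : ℕ →₀ ℤ) (t : InfTorus) : chi δ (-t) = (chi δ t)⁻¹ := by
  apply eq_inv_of_mul_eq_one_left
  rw [← chi_apply_add, neg_add_cancel, chi_apply_zero]

theorem chi_apply_sub (δ : ℕ →₀ ℤ) (s t : InfTorus) :
    chi δ (s - t) = chi δ s * chi (-δ) t := by
  rw [sub_eq_add_neg, chi_apply_add, chi_apply_neg, chi_neg]

theorem conj_chi (δ : ℕ →₀ ℤ) (t : InfTorus) : (starRingEnd ℂ) (chi δ t) = chi (-δ) t := by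
  rw [chi_neg, Complex.inv_def, Complex.normSq_eq_norm_sq, norm_chi]; simp

@[fun_prop]
theorem continuous_chi (δ : ℕ →₀ ℤ) : Continuous (chi δ) := by
  unfold chi zMonomial Finsupp.prod
  refine continuous_finsetProd _ fun j _ => ?_
  refine Continuous.zpow₀ ?_ _ fun t => Or.inl (coord_ne_zero t j)
  unfold coord
  fun_prop

/-- Orthogonality of the characters: translating the `j`-th coordinate by half a period of
`χ_δ` changes the sign of `χ_δ`. -/
theorem integral_chi (δ : ℕ →₀ ℤ) :
    ∫ t, chi δ t ∂torusMeasure = if δ = 0 then 1 else 0 := by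
  split_ifs with h
  · subst h; simp [chi_zero]
  · obtain ⟨j, hj⟩ := Finsupp.ne_iff.1 h
    let s : InfTorus := Pi.single j ((1 / 2 / (δ j) : ℝ) : UnitAddCircle)
    have hs : chi δ s = -1 := by
      have hjs : j ∈ δ.support := Finsupp.mem_support_iff.2 hj
      unfold chi zMonomial Finsupp.prod
      rw [Finset.prod_eq_single_of_mem j hjs]
      · have := fourier_add_half_inv_index (T := (1 : ℝ)) hj one_pos 0
        simp only [zero_add, fourier_eval_zero] at this
        rw [← this]
        simp only [s, coord, Pi.single_eq_same, fourier_apply, AddCircle.toCircle_zsmul,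
          Circle.coe_zpow]
      · intro i _ hij
        simp [s, coord, hij]
    refine integral_eq_zero_of_add_left_eq_neg (g := s) fun t => ?_
    rw [chi_apply_add, hs]; ring

theorem integrable_of_continuous {Ω E : Type*} [TopologicalSpace Ω] [CompactSpace Ω]
    [MeasurableSpace Ω] [BorelSpace Ω] [NormedAddCommGroup E]
    [SecondCountableTopologyEither Ω E] {μ : Measure Ω} [IsFiniteMeasure μ]
    {f : Ω → E} (hf : Continuous f) : Integrable f μ :=
  hf.integrable_of_hasCompactSupport (HasCompactSupport.of_compactSpace f)

/-! ### Hypercontractive integral kernels -/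

section Generic

set_option linter.unusedSectionVars false

variable {Ω Ω' E : Type*} [TopologicalSpace Ω] [CompactSpace Ω] [T2Space Ω]
  [SecondCountableTopology Ω] [MeasurableSpace Ω] [BorelSpace Ω]
  [TopologicalSpace Ω'] [CompactSpace Ω'] [T2Space Ω']
  [SecondCountableTopology Ω'] [MeasurableSpace Ω'] [BorelSpace Ω']
  [NormedAddCommGroup E] [NormedSpace ℝ E]
  {μ : Measure Ω} [IsProbabilityMeasure μ] {ν : Measure Ω'} [IsProbabilityMeasure ν]

theorem continuous_integral_of_continuous {f : Ω → Ω' → E} (hf : Continuous (Function.uncurry f)) :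
    Continuous fun x => ∫ y, f x y ∂ν := by
  simpa using continuous_parametric_integral_of_continuous (μ := ν) hf isCompact_univ

theorem integral_integral_swap_of_continuous {f : Ω → Ω' → E}
    (hf : Continuous (Function.uncurry f)) :
    ∫ x, ∫ y, f x y ∂ν ∂μ = ∫ y, ∫ x, f x y ∂μ ∂ν :=
  integral_integral_swap_of_hasCompactSupport hf (HasCompactSupport.of_compactSpace _)

theorem sq_integral_mul_le {f g : Ω → ℝ} (hf : Continuous f) (hg : Continuous g) :
    (∫ x, f x * g x ∂μ) ^ 2 ≤ (∫ x, f x ^ 2 ∂μ) * ∫ x, g x ^ 2 ∂μ := by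
  have key : ∀ s : ℝ, 0 ≤ (∫ x, f x ^ 2 ∂μ) * (s * s) + (2 * ∫ x, f x * g x ∂μ) * s
      + ∫ x, g x ^ 2 ∂μ := by
    intro s
    have h : ∫ x, (s * f x + g x) ^ 2 ∂μ = (∫ x, f x ^ 2 ∂μ) * (s * s)
        + (2 * ∫ x, f x * g x ∂μ) * s + ∫ x, g x ^ 2 ∂μ := by
      have : ∀ x, (s * f x + g x) ^ 2 = (s * s) * f x ^ 2 + (2 * s) * (f x * g x) + g x ^ 2 :=
        fun x => by ring
      simp_rw [this]
      rw [integral_add, integral_add, integral_const_mul, integral_const_mul]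
      · ring
      all_goals exact integrable_of_continuous (by fun_prop)
    rw [← h]
    exact integral_nonneg fun x => sq_nonneg _
  have := discrim_le_zero key
  unfold discrim at this
  linarith

/-- Minkowski's inequality for the mixed norms `L_2(ν; L_1(μ))` and `L_1(μ; L_2(ν))`, with a
majorant `c x` in place of the norm of `F x` in `L_2(ν)`. -/
theorem integral_sq_integral_le {F : Ω → Ω' → ℝ} (hF : Continuous (Function.uncurry F))
    {c : Ω → ℝ} (hc : Continuous c) (hc0 : ∀ x, 0 ≤ c x)
    (h : ∀ x, ∫ y, F x y ^ 2 ∂ν ≤ c x ^ 2) :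
    ∫ y, (∫ x, F x y ∂μ) ^ 2 ∂ν ≤ (∫ x, c x ∂μ) ^ 2 := by
  set G : Ω' → ℝ := fun y => ∫ x, F x y ∂μ with hG
  have hF' : Continuous (Function.uncurry fun y x => F x y) := hF.comp continuous_swap
  have hGc : Continuous G := continuous_integral_of_continuous hF'
  set A := ∫ y, G y ^ 2 ∂ν with hA
  have hA0 : 0 ≤ A := integral_nonneg fun y => sq_nonneg _
  have h1 : A = ∫ x, ∫ y, G y * F x y ∂ν ∂μ := by
    rw [integral_integral_swap_of_continuous]
    · refine integral_congr_ae (.of_forall fun y => ?_)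
      simp only
      rw [integral_const_mul, sq]
    · have : Continuous fun p : Ω × Ω' => G p.2 := hGc.comp continuous_snd
      exact this.mul hF
  have h2 : A ≤ Real.sqrt A * ∫ x, c x ∂μ := by
    rw [← integral_const_mul]
    nth_rewrite 1 [h1]
    refine integral_mono (integrable_of_continuous ?_) (integrable_of_continuous (by fun_prop)) ?_
    · refine continuous_integral_of_continuous ?_
      have : Continuous fun p : Ω × Ω' => G p.2 := hGc.comp continuous_snd
      exact this.mul hF
    · intro x
      have hx : Continuous (F x) := hF.comp (Continuous.prodMk_right x)
      refine Real.le_sqrt_of_sq_le (sq_integral_mul_le hGc hx) |>.trans ?_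
      rw [Real.sqrt_mul hA0]
      exact mul_le_mul_of_nonneg_left (Real.sqrt_le_iff.2 ⟨hc0 x, h x⟩) (Real.sqrt_nonneg _)
  have hC : 0 ≤ ∫ x, c x ∂μ := integral_nonneg hc0
  have hs := Real.sq_sqrt hA0
  rcases (Real.sqrt_nonneg A).eq_or_lt with h0 | h0
  · rw [← h0] at hs; rw [← hs]; simpa using sq_nonneg _
  · have : Real.sqrt A ≤ ∫ x, c x ∂μ := by
      have h3 : Real.sqrt A * Real.sqrt A ≤ Real.sqrt A * ∫ x, c x ∂μ := by nlinarith
      exact le_of_mul_le_mul_left h3 h0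
    rw [← hs]
    exact pow_le_pow_left₀ (Real.sqrt_nonneg _) this 2

/-- The integral operator with continuous kernel `K` is a contraction from `L_2(μ)` to `L_4(μ)`
on continuous functions. -/
structure IsHypercontractiveKernel (μ : Measure Ω) (K : Ω → Ω → ℝ) : Prop where
  continuous : Continuous (Function.uncurry K)
  integral_pow_four_le : ∀ h : Ω → ℝ, Continuous h →
    ∫ x, (∫ y, K x y * h y ∂μ) ^ 4 ∂μ ≤ (∫ x, h x ^ 2 ∂μ) ^ 2

/-- A doubly stochastic kernel that is uniformly within `1 / 2` of the constant `1` is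
hypercontractive: it preserves the mean `a` of `h`, and the image `g` of `h - a` has mean zero and
satisfies `g² ≤ ‖h - a‖₂² / 4` pointwise, so the fourth moment of `a + g` can be expanded. -/
theorem IsHypercontractiveKernel.of_near_one {K : Ω → Ω → ℝ} (hK : Continuous (Function.uncurry K))
    (hK1 : ∀ x y, |K x y - 1| ≤ 1 / 2) (hr : ∀ x, ∫ y, K x y ∂μ = 1)
    (hl : ∀ y, ∫ x, K x y ∂μ = 1) : IsHypercontractiveKernel μ K := by
  refine ⟨hK, fun h hh => ?_⟩
  set a := ∫ x, h x ∂μ with ha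
  set b := ∫ x, (h x - a) ^ 2 ∂μ with hb
  set g : Ω → ℝ := fun x => ∫ y, (K x y - 1) * (h y - a) ∂μ with hg
  have hKx : ∀ x, Continuous (K x) := fun x => hK.comp (Continuous.prodMk_right x)
  have hKy : ∀ y, Continuous fun x => K x y := fun y => hK.comp (Continuous.prodMk_left y)
  have hgK : Continuous (Function.uncurry fun x y => (K x y - 1) * (h y - a)) := by
    have : Continuous fun p : Ω × Ω => h p.2 := hh.comp continuous_snd
    exact (hK.sub continuous_const).mul (this.sub continuous_const)
  have hgc : Continuous g := continuous_integral_of_continuous hgK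
  have hb' : b = (∫ x, h x ^ 2 ∂μ) - a ^ 2 := by
    have : ∀ x, (h x - a) ^ 2 = h x ^ 2 - 2 * a * h x + a ^ 2 := fun x => by ring
    simp_rw [hb, this]
    rw [integral_add, integral_sub, integral_const_mul, ← ha]
    · simp; ring
    all_goals exact integrable_of_continuous (by fun_prop)
  have hb0 : 0 ≤ b := integral_nonneg fun x => sq_nonneg _
  have hdec : ∀ x, ∫ y, K x y * h y ∂μ = a + g x := by
    intro x
    have := hKx x
    have h1 : ∀ y, (K x y - 1) * (h y - a) = K x y * h y - a * K x y - h y + a :=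
      fun y => by ring
    simp_rw [hg, h1]
    rw [integral_add, integral_sub, integral_sub, integral_const_mul, hr, ← ha]
    · simp
    all_goals exact integrable_of_continuous (by fun_prop)
  have hg0 : ∫ x, g x ∂μ = 0 := by
    rw [hg, integral_integral_swap_of_continuous hgK]
    refine integral_eq_zero_of_ae (.of_forall fun y => ?_)
    have := hKy y
    simp only [Pi.zero_apply]
    rw [integral_mul_const, integral_sub, hl]
    · simp
    all_goals exact integrable_of_continuous (by fun_prop)
  have hg2 : ∀ x, g x ^ 2 ≤ b / 4 := by
    intro x
    have := hKx x
    refine (sq_integral_mul_le (by fun_prop) (by fun_prop)).trans ?_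
    have h1 : ∫ y, (K x y - 1) ^ 2 ∂μ ≤ 1 / 4 := by
      have : ∫ y, (K x y - 1) ^ 2 ∂μ ≤ ∫ y, (1 / 4 : ℝ) ∂μ := by
        refine integral_mono (integrable_of_continuous (by fun_prop)) (by simp) fun y => ?_
        have := sq_le_sq' (abs_le.1 (hK1 x y)).1 (abs_le.1 (hK1 x y)).2
        norm_num at this ⊢; linarith
      simpa using this
    calc _ ≤ 1 / 4 * b := mul_le_mul_of_nonneg_right h1 hb0
      _ = b / 4 := by ring
  have hpt : ∀ x, (a + g x) ^ 4 ≤ (a ^ 4 + 2 * a ^ 2 * b + b ^ 2) + 4 * a ^ 3 * g x := by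
    intro x
    have h2 := hg2 x
    have h3 : g x ^ 4 ≤ b ^ 2 / 16 := by nlinarith [sq_nonneg (g x)]
    have h4 : a ^ 2 * g x ^ 2 ≤ a ^ 2 * (b / 4) := mul_le_mul_of_nonneg_left h2 (sq_nonneg a)
    -- `4 a g³ ≤ 2 a² g² + 2 g⁴`
    nlinarith [sq_nonneg (g x * (a - g x))]
  simp_rw [hdec]
  calc ∫ x, (a + g x) ^ 4 ∂μ
      ≤ ∫ x, ((a ^ 4 + 2 * a ^ 2 * b + b ^ 2) + 4 * a ^ 3 * g x) ∂μ :=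
        integral_mono (integrable_of_continuous (by fun_prop))
          (integrable_of_continuous (by fun_prop)) hpt
    _ = a ^ 4 + 2 * a ^ 2 * b + b ^ 2 := by
        rw [integral_add, integral_const_mul, hg0]
        · simp
        all_goals exact integrable_of_continuous (by fun_prop)
    _ = (∫ x, h x ^ 2 ∂μ) ^ 2 := by rw [hb']; ring

theorem IsHypercontractiveKernel.one : IsHypercontractiveKernel μ fun _ _ => 1 :=
  .of_near_one continuous_const (by norm_num) (by simp) (by simp)

/-- Hypercontractivity tensorizes: apply it in one variable after the other, exchanging the mixed
norms in between by Minkowski's inequality. -/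
theorem IsHypercontractiveKernel.prod {K : Ω → Ω → ℝ} {L : Ω' → Ω' → ℝ}
    (hK : IsHypercontractiveKernel μ K) (hL : IsHypercontractiveKernel ν L) :
    IsHypercontractiveKernel (μ.prod ν) fun p p' => K p.1 p'.1 * L p.2 p'.2 := by
  have hKc := hK.continuous
  have hLc := hL.continuous
  have hKL : Continuous (Function.uncurry fun p p' : Ω × Ω' => K p.1 p'.1 * L p.2 p'.2) := by
    have h1 : Continuous fun q : (Ω × Ω') × (Ω × Ω') => K q.1.1 q.2.1 :=
      hKc.comp (by fun_prop : Continuous fun q : (Ω × Ω') × (Ω × Ω') => (q.1.1, q.2.1))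
    have h2 : Continuous fun q : (Ω × Ω') × (Ω × Ω') => L q.1.2 q.2.2 :=
      hLc.comp (by fun_prop : Continuous fun q : (Ω × Ω') × (Ω × Ω') => (q.1.2, q.2.2))
    exact h1.mul h2
  refine ⟨hKL, fun h hh => ?_⟩
  set g : Ω → Ω' → ℝ := fun x y => ∫ y', L y y' * h (x, y') ∂ν with hg
  have hgc : Continuous (Function.uncurry g) := by
    refine continuous_integral_of_continuous
      (f := fun (p : Ω × Ω') y' => L p.2 y' * h (p.1, y')) ?_
    have h1 : Continuous fun q : (Ω × Ω') × Ω' => L q.1.2 q.2 :=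
      hLc.comp (by fun_prop : Continuous fun q : (Ω × Ω') × Ω' => (q.1.2, q.2))
    have h2 : Continuous fun q : (Ω × Ω') × Ω' => h (q.1.1, q.2) := by fun_prop
    exact h1.mul h2
  have hgy : ∀ y, Continuous fun x => g x y := fun y => hgc.comp (Continuous.prodMk_left y)
  set G : Ω → Ω' → ℝ := fun x y => ∫ x', K x x' * g x' y ∂μ with hG
  have hGc : Continuous (Function.uncurry G) := by
    refine continuous_integral_of_continuous
      (f := fun (p : Ω × Ω') x' => K p.1 x' * g x' p.2) ?_
    have h1 : Continuous fun q : (Ω × Ω') × Ω => K q.1.1 q.2 :=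
      hKc.comp (by fun_prop : Continuous fun q : (Ω × Ω') × Ω => (q.1.1, q.2))
    have h2 : Continuous fun q : (Ω × Ω') × Ω => g q.2 q.1.2 :=
      hgc.comp (by fun_prop : Continuous fun q : (Ω × Ω') × Ω => (q.2, q.1.2))
    exact h1.mul h2
  have hfac : ∀ p : Ω × Ω', ∫ p', K p.1 p'.1 * L p.2 p'.2 * h p' ∂(μ.prod ν) = G p.1 p.2 := by
    intro p
    rw [integral_prod]
    · simp only [hG, hg]
      refine integral_congr_ae (.of_forall fun x' => ?_)
      simp only
      rw [← integral_const_mul]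
      refine integral_congr_ae (.of_forall fun y' => ?_)
      simp only
      ring
    · exact integrable_of_continuous ((hKL.comp (Continuous.prodMk_right p)).mul hh)
  simp_rw [hfac]
  have hswap : ∫ p : Ω × Ω', G p.1 p.2 ^ 4 ∂(μ.prod ν) = ∫ y, ∫ x, G x y ^ 4 ∂μ ∂ν := by
    have : Continuous fun p : Ω × Ω' => G p.1 p.2 ^ 4 := hGc.pow 4
    rw [integral_prod _ (integrable_of_continuous this),
      integral_integral_swap_of_continuous this]
  have hsq : Continuous (Function.uncurry fun (x : Ω) (y : Ω') => h (x, y) ^ 2) := by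
    exact hh.pow 2
  rw [hswap]
  calc ∫ y, ∫ x, G x y ^ 4 ∂μ ∂ν ≤ ∫ y, (∫ x, g x y ^ 2 ∂μ) ^ 2 ∂ν := by
        refine integral_mono (integrable_of_continuous ?_) (integrable_of_continuous ?_) ?_
        · have : Continuous fun p : Ω' × Ω => G p.2 p.1 ^ 4 := (hGc.comp continuous_swap).pow 4
          exact continuous_integral_of_continuous (f := fun y x => G x y ^ 4) this
        · have : Continuous fun p : Ω' × Ω => g p.2 p.1 ^ 2 := (hgc.comp continuous_swap).pow 2
          exact (continuous_integral_of_continuous (f := fun y x => g x y ^ 2) this).pow 2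
        · exact fun y => hK.integral_pow_four_le _ (hgy y)
    _ ≤ (∫ x, ∫ y, h (x, y) ^ 2 ∂ν ∂μ) ^ 2 := by
        have hgsq : Continuous fun p : Ω × Ω' => g p.1 p.2 ^ 2 := hgc.pow 2
        refine integral_sq_integral_le (F := fun x y => g x y ^ 2) hgsq
          (continuous_integral_of_continuous hsq)
          (fun x => integral_nonneg fun y => sq_nonneg _) fun x => ?_
        have := hL.integral_pow_four_le (fun y => h (x, y)) (by fun_prop)
        simp only [← pow_mul]
        exact this
    _ = (∫ p, h p ^ 2 ∂(μ.prod ν)) ^ 2 := by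
        have hsq' : Continuous fun p => h p ^ 2 := hh.pow 2
        rw [integral_prod _ (integrable_of_continuous hsq')]

theorem IsHypercontractiveKernel.of_measurePreserving {K : Ω → Ω → ℝ} {φ : Ω' → Ω}
    (hφ : Continuous φ) (hmp : MeasurePreserving φ ν μ) (hK : Continuous (Function.uncurry K))
    (h : IsHypercontractiveKernel ν fun x y => K (φ x) (φ y)) : IsHypercontractiveKernel μ K := by
  have hint : ∀ f : Ω → ℝ, Continuous f → ∫ x, f x ∂μ = ∫ x, f (φ x) ∂ν := by
    intro f hf
    rw [← hmp.map_eq, integral_map hφ.measurable.aemeasurable hf.aestronglyMeasurable]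
  refine ⟨hK, fun f hf => ?_⟩
  have h1 : Continuous (Function.uncurry fun x y => K x y * f y) := by
    have : Continuous fun p : Ω × Ω => f p.2 := hf.comp continuous_snd
    exact hK.mul this
  have h2 : ∀ x, Continuous fun y => K x y * f y := fun x => h1.comp (Continuous.prodMk_right x)
  have h4 : Continuous fun x => (∫ y, K x y * f y ∂μ) ^ 4 :=
    (continuous_integral_of_continuous h1).pow 4
  have hf2 : Continuous fun x => f x ^ 2 := hf.pow 2
  rw [hint _ h4, hint _ hf2]
  simp_rw [fun x => hint _ (h2 x)]
  exact h.integral_pow_four_le _ (hf.comp hφ)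

end Generic

/-! ### A hypercontractive convolution kernel on the infinite torus -/

/-- Prepending a coordinate to a point of the infinite torus. -/
def torusCons (p : UnitAddCircle × InfTorus) : InfTorus
  | 0 => p.1
  | n + 1 => p.2 n

theorem continuous_torusCons : Continuous torusCons := by
  refine continuous_pi fun n => ?_
  cases n with
  | zero => exact continuous_fst
  | succ n => exact (continuous_apply n).comp continuous_snd

theorem measurePreserving_torusCons :
    MeasurePreserving torusCons
      ((AddCircle.haarAddCircle : Measure UnitAddCircle).prod torusMeasure) torusMeasure := by
  refine ⟨continuous_torusCons.measurable, ?_⟩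
  refine Measure.eq_infinitePi _ fun s t ht => ?_
  classical
  obtain ⟨M, hM⟩ : ∃ M, s ⊆ Finset.range (M + 1) :=
    ⟨s.sup id, fun i hi => Finset.mem_range.2 (Nat.lt_succ_of_le (Finset.le_sup (f := id) hi))⟩
  set t' : ℕ → Set UnitAddCircle := fun i => if i ∈ s then t i else Set.univ with ht'
  have ht'm : ∀ i, MeasurableSet (t' i) := fun i => by
    simp only [ht']; split_ifs
    exacts [ht i, .univ]
  have hset : (s : Set ℕ).pi t = (Finset.range (M + 1) : Set ℕ).pi t' := by
    ext x
    simp only [Set.mem_pi, Finset.mem_coe, ht']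
    refine ⟨fun h i _ => ?_, fun h i hi => ?_⟩
    · split_ifs with hi
      exacts [h i hi, Set.mem_univ _]
    · simpa [hi] using h i (hM hi)
  have hprod : ∏ i ∈ s, (AddCircle.haarAddCircle : Measure UnitAddCircle) (t i)
      = ∏ i ∈ Finset.range (M + 1), (AddCircle.haarAddCircle : Measure UnitAddCircle) (t' i) := by
    rw [← Finset.prod_subset hM fun i _ hi => by simp [ht', hi]]
    exact Finset.prod_congr rfl fun i hi => by simp [ht', hi]
  have hpre : torusCons ⁻¹' ((Finset.range (M + 1) : Set ℕ).pi t')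
      = t' 0 ×ˢ (Finset.range M : Set ℕ).pi fun i => t' (i + 1) := by
    ext p
    simp only [Set.mem_preimage, Set.mem_pi, Finset.coe_range, Set.mem_Iio, Set.mem_prod]
    refine ⟨fun h => ⟨h 0 (by omega), fun i hi => h (i + 1) (by omega)⟩, fun h i hi => ?_⟩
    cases i with
    | zero => exact h.1
    | succ i => exact h.2 i (by omega)
  rw [hset, Measure.map_apply continuous_torusCons.measurable
    (.pi (Finset.countable_toSet _) fun i _ => ht'm i), hpre, Measure.prod_prod, hprod,
    Finset.prod_range_succ', mul_comm, torusMeasure, Measure.infinitePi_pi _ fun i _ => ht'm _]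

/-- The convolution kernel `∏_{j < N} k(t_j - s_j)` on the infinite torus. -/
def torusKernel (k : UnitAddCircle → ℝ) (N : ℕ) (t s : InfTorus) : ℝ :=
  ∏ j ∈ Finset.range N, k (t j - s j)

theorem continuous_torusKernel {k : UnitAddCircle → ℝ} (hk : Continuous k) (N : ℕ) :
    Continuous (Function.uncurry (torusKernel k N)) := by
  unfold torusKernel Function.uncurry
  fun_prop

theorem IsHypercontractiveKernel.torusKernel {k : UnitAddCircle → ℝ}
    (hk : Continuous k)
    (h : IsHypercontractiveKernel AddCircle.haarAddCircle fun x y => k (x - y)) (N : ℕ) :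
    IsHypercontractiveKernel torusMeasure (torusKernel k N) := by
  induction N with
  | zero =>
    exact cast (by congr 1) (IsHypercontractiveKernel.one (μ := torusMeasure))
  | succ N ih =>
    refine .of_measurePreserving continuous_torusCons measurePreserving_torusCons
      (continuous_torusKernel hk _) ?_
    have := h.prod ih
    refine cast ?_ this
    congr 1
    ext p p'
    exact ((Finset.prod_range_succ' _ N).trans (mul_comm _ _)).symm

/-- The real trigonometric polynomial `∑_{|n| ≤ D} 5 ^ (-|n|) e^{2 π i n x}`, a truncation of the
Poisson kernel. The ratio `1 / 5` makes its distance to `1` at most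
`2 * (1 / 5) / (1 - 1 / 5) = 1 / 2`, as `IsHypercontractiveKernel.of_near_one` requires. -/
def truncPoisson (D : ℕ) (x : UnitAddCircle) : ℝ :=
  1 + ∑ n ∈ Finset.range D, 2 * (1 / 5) ^ (n + 1) * (fourier ((n : ℤ) + 1) x : ℂ).re

@[fun_prop]
theorem continuous_truncPoisson (D : ℕ) : Continuous (truncPoisson D) := by
  unfold truncPoisson
  fun_prop

theorem abs_truncPoisson_sub_one_le (D : ℕ) (x : UnitAddCircle) :
    |truncPoisson D x - 1| ≤ 1 / 2 := by
  rw [truncPoisson, add_sub_cancel_left]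
  calc _ ≤ ∑ n ∈ Finset.range D, |2 * (1 / 5) ^ (n + 1) * (fourier ((n : ℤ) + 1) x : ℂ).re| :=
        Finset.abs_sum_le_sum_abs _ _
    _ ≤ ∑ n ∈ Finset.range D, (2 / 5) * (1 / 5 : ℝ) ^ n := by
        refine Finset.sum_le_sum fun n _ => ?_
        rw [abs_mul, abs_of_pos (by positivity)]
        have : |(fourier ((n : ℤ) + 1) x : ℂ).re| ≤ 1 :=
          (Complex.abs_re_le_norm _).trans (by rw [fourier_apply, Circle.norm_coe])
        calc _ ≤ 2 * (1 / 5 : ℝ) ^ (n + 1) * 1 := mul_le_mul_of_nonneg_left this (by positivity)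
          _ = _ := by ring
    _ = (2 / 5) * ∑ n ∈ Finset.range D, (1 / 5 : ℝ) ^ n := (Finset.mul_sum _ _ _).symm
    _ ≤ (2 / 5) * (1 - 1 / 5)⁻¹ := by
        refine mul_le_mul_of_nonneg_left ?_ (by norm_num)
        rw [← tsum_geometric_of_lt_one (by norm_num) (by norm_num : (1 / 5 : ℝ) < 1)]
        exact (summable_geometric_of_lt_one (by norm_num) (by norm_num)).sum_le_tsum _
          fun _ _ => by positivity
    _ = 1 / 2 := by norm_num

theorem truncPoisson_nonneg (D : ℕ) (x : UnitAddCircle) : 0 ≤ truncPoisson D x := by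
  have := (abs_le.1 (abs_truncPoisson_sub_one_le D x)).1
  linarith

theorem ofReal_truncPoisson (D : ℕ) (x : UnitAddCircle) :
    (truncPoisson D x : ℂ) = 1 + ∑ n ∈ Finset.range D, (1 / 5 : ℂ) ^ (n + 1) *
      (fourier ((n : ℤ) + 1) x + fourier (-((n : ℤ) + 1)) x) := by
  unfold truncPoisson
  push_cast
  congr 1
  refine Finset.sum_congr rfl fun n _ => ?_
  rw [fourier_neg, Complex.add_conj]
  push_cast
  ring

theorem fourier_apply_sub (n : ℤ) (x y : UnitAddCircle) :
    (fourier n (x - y) : ℂ) = fourier n x * fourier (-n) y := by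
  simp only [fourier_apply, AddCircle.toCircle_zsmul, sub_eq_add_neg, AddCircle.toCircle_add,
    AddCircle.toCircle_neg, mul_zpow, inv_zpow', Circle.coe_mul]

theorem integral_fourier_sub_mul (n m : ℤ) (x : UnitAddCircle) :
    ∫ y, (fourier n (x - y) : ℂ) * fourier m y ∂AddCircle.haarAddCircle
      = if n = m then fourier m x else 0 := by
  simp_rw [fourier_apply_sub, mul_assoc]
  rw [integral_const_mul]
  have := congrFun (fourierCoeff_fourier (T := (1 : ℝ)) m) n
  rw [fourierCoeff] at this
  simp only [smul_eq_mul] at this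
  rw [this]
  split_ifs with h
  · subst h; simp
  · simp [h]

theorem integral_truncPoisson_sub_mul {D m : ℕ} (hm : m ≤ D) (x : UnitAddCircle) :
    ∫ y, (truncPoisson D (x - y) : ℂ) * fourier (m : ℤ) y ∂AddCircle.haarAddCircle
      = (1 / 5) ^ m * fourier (m : ℤ) x := by
  have h0 : ∀ y : UnitAddCircle, (truncPoisson D (x - y) : ℂ) * fourier (m : ℤ) y
      = fourier 0 (x - y) * fourier (m : ℤ) y + ∑ n ∈ Finset.range D, (1 / 5 : ℂ) ^ (n + 1) *
      (fourier ((n : ℤ) + 1) (x - y) * fourier (m : ℤ) y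
        + fourier (-((n : ℤ) + 1)) (x - y) * fourier (m : ℤ) y) := by
    intro y
    rw [ofReal_truncPoisson, fourier_zero, add_mul, Finset.sum_mul]
    congr 1
    exact Finset.sum_congr rfl fun n _ => by ring
  simp_rw [h0]
  have hi : ∀ n : ℤ, Integrable (fun y : UnitAddCircle =>
      (fourier n (x - y) : ℂ) * fourier (m : ℤ) y) AddCircle.haarAddCircle :=
    fun n => integrable_of_continuous (by fun_prop)
  rw [integral_add (hi 0), integral_finsetSum]
  · simp_rw [integral_const_mul, integral_add (hi _) (hi _), integral_fourier_sub_mul]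
    have hneg : ∀ n : ℕ, ¬ (-((n : ℤ) + 1) = m) := fun n => by omega
    simp_rw [if_neg (hneg _), add_zero]
    cases m with
    | zero =>
      have : ∀ n : ℕ, ¬ ((n : ℤ) + 1 = (0 : ℕ)) := fun n => by omega
      simp_rw [if_neg (this _)]
      simp
    | succ m =>
      rw [if_neg (by omega), zero_add, Finset.sum_eq_single m]
      · simp
      · intro n _ hn
        rw [if_neg (by omega), mul_zero]
      · intro h
        exact absurd (Finset.mem_range.2 (by omega)) h
  · exact fun n _ => ((hi _).add (hi _)).const_mul _
  · exact integrable_finsetSum _ fun n _ => ((hi _).add (hi _)).const_mul _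

theorem integral_truncPoisson_sub (D : ℕ) (x : UnitAddCircle) :
    ∫ y, truncPoisson D (x - y) ∂AddCircle.haarAddCircle = 1 := by
  have := integral_truncPoisson_sub_mul (Nat.zero_le D) x
  simp only [Nat.cast_zero, fourier_zero, mul_one, pow_zero] at this
  rw [integral_complex_ofReal] at this
  exact_mod_cast this

theorem isHypercontractiveKernel_truncPoisson (D : ℕ) :
    IsHypercontractiveKernel AddCircle.haarAddCircle fun x y => truncPoisson D (x - y) := by
  refine .of_near_one (by unfold Function.uncurry; fun_prop)
    (fun x y => abs_truncPoisson_sub_one_le D _) (integral_truncPoisson_sub D) fun y => ?_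
  rw [integral_sub_right_eq_self (truncPoisson D)]
  exact (integral_sub_left_eq_self (truncPoisson D) _ 0).symm.trans (integral_truncPoisson_sub D 0)

theorem monomial_coord_eq_prod_range {α : ℕ →₀ ℕ} {N : ℕ} (hα : α.support ⊆ Finset.range N)
    (t : InfTorus) :
    monomial (coord t) α = ∏ j ∈ Finset.range N, (fourier (α j : ℤ) (t j) : ℂ) := by
  rw [monomial, Finsupp.prod_of_support_subset _ hα _ (by simp)]
  refine Finset.prod_congr rfl fun j _ => ?_
  simp [coord, fourier_apply, AddCircle.toCircle_nsmul]

theorem integral_prod_range {N : ℕ} {g : ℕ → UnitAddCircle → ℂ} (hg : ∀ j, Continuous (g j)) :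
    ∫ t : InfTorus, ∏ j ∈ Finset.range N, g j (t j) ∂torusMeasure
      = ∏ j ∈ Finset.range N, ∫ x, g j x ∂AddCircle.haarAddCircle := by
  have h1 : ProbabilityTheory.iIndepFun (fun (j : ℕ) (t : InfTorus) => g j (t j)) torusMeasure :=
    ProbabilityTheory.iIndepFun_infinitePi fun j => (hg j).measurable
  have h2 := (h1.precomp (Fin.val_injective (n := N))).integral_fun_prod_eq_prod_integral
    fun j => ((hg j).comp (continuous_apply (j : ℕ))).aestronglyMeasurable
  simp_rw [Finset.prod_range]
  rw [h2]
  refine Finset.prod_congr rfl fun j _ => ?_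
  have h3 := measurePreserving_eval_infinitePi
    (fun _ : ℕ => (AddCircle.haarAddCircle : Measure UnitAddCircle)) j
  have h4 := integral_map (μ := torusMeasure) h3.measurable.aemeasurable
    (f := g j) (hg j).aestronglyMeasurable
  have h5 := h3.map_eq
  rw [← torusMeasure] at h5
  rw [h5] at h4
  exact h4.symm

theorem integral_torusKernel_mul_monomial {α : ℕ →₀ ℕ} {N D : ℕ}
    (hα : α.support ⊆ Finset.range N) (hD : ∀ j, α j ≤ D) (t : InfTorus) :
    ∫ s, (torusKernel (truncPoisson D) N t s : ℂ) * monomial (coord s) α ∂torusMeasure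
      = (1 / 5) ^ α.degree * monomial (coord t) α := by
  simp_rw [monomial_coord_eq_prod_range hα, torusKernel, Complex.ofReal_prod,
    ← Finset.prod_mul_distrib]
  rw [integral_prod_range (g := fun j x => (truncPoisson D (t j - x) : ℂ) * fourier (α j : ℤ) x)
    fun j => by fun_prop]
  simp_rw [integral_truncPoisson_sub_mul (hD _)]
  rw [Finset.prod_mul_distrib, Finset.prod_pow_eq_pow_sum, Finsupp.degree_apply,
    Finset.sum_subset hα fun j _ hj => by simpa using hj]

/-! ### Homogeneous polynomials: comparison of moments and averaging over rotations -/

variable {X : Type*} [NormedAddCommGroup X] [NormedSpace ℂ X]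

/-- The analytic polynomial `∑_{α ∈ S} x_α z ^ α` as a function on the infinite torus. -/
def torusPoly (S : Finset (ℕ →₀ ℕ)) (x : (ℕ →₀ ℕ) → X) (t : InfTorus) : X :=
  ∑ α ∈ S, monomial (coord t) α • x α

@[fun_prop]
theorem continuous_monomial_coord (α : ℕ →₀ ℕ) : Continuous fun t => monomial (coord t) α := by
  simp_rw [monomial_coord]
  fun_prop

@[fun_prop]
theorem continuous_torusPoly (S : Finset (ℕ →₀ ℕ)) (x : (ℕ →₀ ℕ) → X) :
    Continuous (torusPoly S x) := by
  unfold torusPoly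
  fun_prop

theorem norm_monomial_coord (t : InfTorus) (α : ℕ →₀ ℕ) : ‖monomial (coord t) α‖ = 1 := by
  rw [monomial_coord, norm_chi]

/-- Reverse Hölder inequality by interpolation of `L_2` between `L_1` and `L_4`: if the fourth
moment is at most `ρ⁻⁴` times the square of the second one, then the second moment is at most
`ρ⁻⁴` times the square of the first one. -/
theorem pow_four_mul_integral_sq_le {h : InfTorus → ℝ} (hc : Continuous h) (hh0 : ∀ t, 0 ≤ h t)
    {ρ : ℝ} (hQA : ρ ^ 4 * ∫ t, h t ^ 4 ∂torusMeasure ≤ (∫ t, h t ^ 2 ∂torusMeasure) ^ 2) :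
    ρ ^ 4 * ∫ t, h t ^ 2 ∂torusMeasure ≤ (∫ t, h t ∂torusMeasure) ^ 2 := by
  have hs : Continuous fun t => Real.sqrt (h t) := hc.sqrt
  have h1 : (∫ t, h t ^ 2 ∂torusMeasure) ^ 2
      ≤ (∫ t, h t ∂torusMeasure) * ∫ t, h t ^ 3 ∂torusMeasure := by
    have hsc : Continuous fun t => Real.sqrt (h t) * h t := hs.mul hc
    have := sq_integral_mul_le (μ := torusMeasure) hs hsc
    have e1 : ∀ t, Real.sqrt (h t) * (Real.sqrt (h t) * h t) = h t ^ 2 := fun t => by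
      rw [← mul_assoc, Real.mul_self_sqrt (hh0 t), sq]
    have e2 : ∀ t, (Real.sqrt (h t) * h t) ^ 2 = h t ^ 3 := fun t => by
      rw [mul_pow, Real.sq_sqrt (hh0 t)]; ring
    simp_rw [e1, e2, fun t => Real.sq_sqrt (hh0 t)] at this
    exact this
  have h2 : (∫ t, h t ^ 3 ∂torusMeasure) ^ 2
      ≤ (∫ t, h t ^ 2 ∂torusMeasure) * ∫ t, h t ^ 4 ∂torusMeasure := by
    have hc2 : Continuous fun t => h t ^ 2 := hc.pow 2
    have := sq_integral_mul_le (μ := torusMeasure) hc hc2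
    have e1 : ∀ t, h t * h t ^ 2 = h t ^ 3 := fun t => by ring
    have e2 : ∀ t, (h t ^ 2) ^ 2 = h t ^ 4 := fun t => by ring
    simp_rw [e1, e2] at this
    exact this
  have hA0 : 0 ≤ ∫ t, h t ^ 2 ∂torusMeasure := integral_nonneg fun t => sq_nonneg _
  generalize ∫ t, h t ^ 2 ∂torusMeasure = A at *
  generalize ∫ t, h t ^ 3 ∂torusMeasure = B at *
  generalize ∫ t, h t ^ 4 ∂torusMeasure = Q at *
  generalize ∫ t, h t ∂torusMeasure = a at *
  have hρ4 : 0 ≤ ρ ^ 4 := by positivity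
  -- eliminate the third moment `B` from the two Cauchy-Schwarz inequalities
  have h3 : A ^ 3 * (ρ ^ 4 * A) ≤ A ^ 3 * a ^ 2 := by
    calc A ^ 3 * (ρ ^ 4 * A) = ρ ^ 4 * (A ^ 2) ^ 2 := by ring
      _ ≤ ρ ^ 4 * (a * B) ^ 2 := by gcongr
      _ = ρ ^ 4 * (a ^ 2 * B ^ 2) := by ring
      _ ≤ ρ ^ 4 * (a ^ 2 * (A * Q)) := by gcongr
      _ = a ^ 2 * A * (ρ ^ 4 * Q) := by ring
      _ ≤ a ^ 2 * A * A ^ 2 := by gcongr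
      _ = A ^ 3 * a ^ 2 := by ring
  rcases hA0.eq_or_lt with h0 | h0
  · rw [← h0]; simpa using sq_nonneg a
  · exact le_of_mul_le_mul_left h3 (by positivity)

/-- Convolution with the kernel acts on an `m`-homogeneous polynomial as multiplication by
`5 ^ (-m)`, and the kernel is positive. -/
theorem pow_mul_norm_torusPoly_le [CompleteSpace X] {m N : ℕ} {S : Finset (ℕ →₀ ℕ)}
    (hS : ∀ α ∈ S, α.degree = m) (hN : ∀ α ∈ S, α.support ⊆ Finset.range N)
    (x : (ℕ →₀ ℕ) → X) (t : InfTorus) :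
    (1 / 5) ^ m * ‖torusPoly S x t‖
      ≤ ∫ s, torusKernel (truncPoisson m) N t s * ‖torusPoly S x s‖ ∂torusMeasure := by
  have hK0 : ∀ s, 0 ≤ torusKernel (truncPoisson m) N t s :=
    fun s => Finset.prod_nonneg fun j _ => truncPoisson_nonneg _ _
  have hKt : Continuous (torusKernel (truncPoisson m) N t) := by
    unfold torusKernel
    fun_prop
  have heq : ∫ s, (torusKernel (truncPoisson m) N t s : ℂ) • torusPoly S x s ∂torusMeasure
      = ((1 / 5) ^ m : ℂ) • torusPoly S x t := by
    unfold torusPoly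
    simp_rw [Finset.smul_sum, smul_smul]
    rw [integral_finsetSum]
    · refine Finset.sum_congr rfl fun α hα => ?_
      rw [integral_smul_const, integral_torusKernel_mul_monomial (hN α hα), hS α hα]
      exact fun j => (Finsupp.le_degree j α).trans_eq (hS α hα)
    · exact fun α _ => integrable_of_continuous (by fun_prop)
  calc (1 / 5) ^ m * ‖torusPoly S x t‖ = ‖((1 / 5) ^ m : ℂ) • torusPoly S x t‖ := by
        rw [norm_smul]; simp
    _ ≤ ∫ s, ‖(torusKernel (truncPoisson m) N t s : ℂ) • torusPoly S x s‖ ∂torusMeasure := by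
        rw [← heq]; exact norm_integral_le_integral_norm _
    _ = _ := by
        refine integral_congr_ae (.of_forall fun s => ?_)
        simp [norm_smul, abs_of_nonneg (hK0 s)]

theorem exists_support_subset_range (S : Finset (ℕ →₀ ℕ)) :
    ∃ N, ∀ α ∈ S, α.support ⊆ Finset.range N := by
  refine ⟨(S.sup fun α => α.support.sup id) + 1, fun α hα j hj => ?_⟩
  refine Finset.mem_range.2 (Nat.lt_succ_of_le ?_)
  exact (Finset.le_sup (f := id) hj).trans (Finset.le_sup (f := fun α => α.support.sup id) hα)

/-- For an `m`-homogeneous polynomial, the `L_2` norm is at most `25 ^ m` times the `L_1` norm. -/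
theorem integral_sq_norm_torusPoly_le [CompleteSpace X] {m : ℕ} {S : Finset (ℕ →₀ ℕ)}
    (hS : ∀ α ∈ S, α.degree = m) (x : (ℕ →₀ ℕ) → X) :
    ∫ t, ‖torusPoly S x t‖ ^ 2 ∂torusMeasure ≤
      (25 ^ m * ∫ t, ‖torusPoly S x t‖ ∂torusMeasure) ^ 2 := by
  obtain ⟨N, hN⟩ := exists_support_subset_range S
  have hpt := pow_mul_norm_torusPoly_le hS hN x
  have hc : Continuous fun t => ‖torusPoly S x t‖ := (continuous_torusPoly S x).norm
  have hK : IsHypercontractiveKernel torusMeasure (torusKernel (truncPoisson m) N) :=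
    .torusKernel (continuous_truncPoisson m) (isHypercontractiveKernel_truncPoisson m) N
  have hKc : Continuous fun p : InfTorus × InfTorus =>
      torusKernel (truncPoisson m) N p.1 p.2 * ‖torusPoly S x p.2‖ :=
    hK.continuous.mul (hc.comp continuous_snd)
  have hKi : Continuous fun t =>
      (∫ s, torusKernel (truncPoisson m) N t s * ‖torusPoly S x s‖ ∂torusMeasure) ^ 4 :=
    (continuous_integral_of_continuous
      (f := fun t s => torusKernel (truncPoisson m) N t s * ‖torusPoly S x s‖) hKc).pow 4
  have h4 : ((1 / 5 : ℝ) ^ m) ^ 4 * ∫ t, ‖torusPoly S x t‖ ^ 4 ∂torusMeasure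
      ≤ (∫ t, ‖torusPoly S x t‖ ^ 2 ∂torusMeasure) ^ 2 := by
    refine le_trans ?_ (hK.integral_pow_four_le _ hc)
    rw [← integral_const_mul]
    refine integral_mono (integrable_of_continuous (by fun_prop)) (integrable_of_continuous hKi)
      fun t => ?_
    simp only
    rw [← mul_pow]
    exact pow_le_pow_left₀ (mul_nonneg (by positivity) (norm_nonneg _)) (hpt t) 4
  have h5 := pow_four_mul_integral_sq_le hc (fun t => norm_nonneg _) h4
  have h25 : (25 : ℝ) ^ m * ((1 / 5 : ℝ) ^ m) ^ 2 = 1 := by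
    rw [← pow_mul, mul_comm m 2, pow_mul, ← mul_pow]; norm_num
  generalize ∫ t, ‖torusPoly S x t‖ ^ 2 ∂torusMeasure = A at *
  generalize ∫ t, ‖torusPoly S x t‖ ∂torusMeasure = a at *
  calc A = (25 ^ m * ((1 / 5 : ℝ) ^ m) ^ 2) ^ 2 * A := by rw [h25]; ring
    _ = (25 ^ m) ^ 2 * (((1 / 5 : ℝ) ^ m) ^ 4 * A) := by ring
    _ ≤ (25 ^ m) ^ 2 * a ^ 2 := by gcongr
    _ = (25 ^ m * a) ^ 2 := by ring

/-- Rotating the first `k` coordinates independently and all the others simultaneously. -/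
def gluedRotation (k : ℕ) (u : InfTorus) : InfTorus := fun j => u (min j k)

theorem continuous_gluedRotation (k : ℕ) : Continuous (gluedRotation k) :=
  continuous_pi fun _ => continuous_apply _

theorem monomial_gluedRotation (k : ℕ) (α : ℕ →₀ ℕ) (u : InfTorus) :
    monomial (coord (gluedRotation k u)) α
      = chi (toIntIndex (α.mapDomain (min · k))) u := by
  rw [← monomial_coord, monomial, monomial, Finsupp.prod_mapDomain_index (by simp)
    (fun _ _ _ => pow_add _ _ _)]
  rfl

theorem monomial_coord_add (α : ℕ →₀ ℕ) (s t : InfTorus) :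
    monomial (coord (s + t)) α = monomial (coord s) α * monomial (coord t) α := by
  simp_rw [monomial_coord, chi_apply_add]

/-- The part of a polynomial with prescribed exponents of `z_0, …, z_{k-1}` and prescribed total
degree in the remaining variables is an average of rotations of the polynomial, whence its `L_1`
norm is no larger. -/
theorem integral_norm_torusPoly_filter_le [CompleteSpace X] (k : ℕ) (γ : ℕ →₀ ℕ)
    (S : Finset (ℕ →₀ ℕ)) (x : (ℕ →₀ ℕ) → X) :
    ∫ t, ‖torusPoly (S.filter fun α => α.mapDomain (min · k) = γ) x t‖ ∂torusMeasure
      ≤ ∫ t, ‖torusPoly S x t‖ ∂torusMeasure := by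
  have hrot := continuous_gluedRotation k
  have hP := continuous_torusPoly S x
  have heq : ∀ t, torusPoly (S.filter fun α => α.mapDomain (min · k) = γ) x t
      = ∫ u, chi (-toIntIndex γ) u • torusPoly S x (t + gluedRotation k u) ∂torusMeasure := by
    intro t
    unfold torusPoly
    have : ∀ u, chi (-toIntIndex γ) u •
        ∑ α ∈ S, monomial (coord (t + gluedRotation k u)) α • x α
        = ∑ α ∈ S, chi (toIntIndex (α.mapDomain (min · k)) - toIntIndex γ) u •
          (monomial (coord t) α • x α) := by
      intro u
      rw [Finset.smul_sum]
      refine Finset.sum_congr rfl fun α _ => ?_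
      rw [monomial_coord_add, monomial_gluedRotation, sub_eq_add_neg, chi_add, smul_smul, smul_smul]
      congr 1
      ring
    simp_rw [this]
    rw [integral_finsetSum _ fun α _ => integrable_of_continuous (by fun_prop),
      Finset.sum_filter]
    refine Finset.sum_congr rfl fun α _ => ?_
    rw [integral_smul_const, integral_chi]
    simp_rw [sub_eq_zero, toIntIndex_injective.eq_iff]
    split_ifs <;> simp
  have hjoint : Continuous (Function.uncurry fun t u =>
      ‖torusPoly S x (t + gluedRotation k u)‖) := by
    unfold Function.uncurry
    fun_prop
  calc ∫ t, ‖torusPoly (S.filter fun α => α.mapDomain (min · k) = γ) x t‖ ∂torusMeasure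
      ≤ ∫ t, ∫ u, ‖torusPoly S x (t + gluedRotation k u)‖ ∂torusMeasure ∂torusMeasure := by
        refine integral_mono (integrable_of_continuous (by fun_prop))
          (integrable_of_continuous (continuous_integral_of_continuous hjoint)) fun t => ?_
        simp only
        rw [heq t]
        refine (norm_integral_le_integral_norm _).trans_eq ?_
        simp_rw [norm_smul, norm_chi, one_mul]
    _ = ∫ t, ‖torusPoly S x t‖ ∂torusMeasure := by
        rw [integral_integral_swap_of_continuous hjoint]
        simp_rw [fun u => integral_add_right_eq_self (μ := torusMeasure)
          (fun t => ‖torusPoly S x t‖) (gluedRotation k u)]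
        simp

/-! ### Fejér-type kernels and the reduction to polynomials -/

/-- The Fejér-type kernel `|∑_{β ∈ B} z ^ β|² / |B|` of a finite set `B` of exponents. -/
def fejerKernel (B : Finset (ℕ →₀ ℕ)) (t : InfTorus) : ℝ :=
  (B.card : ℝ)⁻¹ * ‖∑ β ∈ B, monomial (coord t) β‖ ^ 2

/-- The Fourier coefficient of `fejerKernel B` at `α ≥ 0`: the proportion of the `β ∈ B` with
`β + α ∈ B`. -/
def fejerCoeff (B : Finset (ℕ →₀ ℕ)) (α : ℕ →₀ ℕ) : ℝ :=
  (B.card : ℝ)⁻¹ * {p ∈ B ×ˢ B | p.2 ≤ p.1 ∧ p.1 - p.2 = α}.card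

theorem fejerCoeff_nonneg (B : Finset (ℕ →₀ ℕ)) (α : ℕ →₀ ℕ) : 0 ≤ fejerCoeff B α := by
  unfold fejerCoeff; positivity

@[fun_prop]
theorem continuous_fejerKernel (B : Finset (ℕ →₀ ℕ)) : Continuous (fejerKernel B) := by
  unfold fejerKernel
  fun_prop

theorem fejerKernel_nonneg (B : Finset (ℕ →₀ ℕ)) (t : InfTorus) : 0 ≤ fejerKernel B t := by
  unfold fejerKernel; positivity

theorem ofReal_fejerKernel (B : Finset (ℕ →₀ ℕ)) (t : InfTorus) :
    (fejerKernel B t : ℂ) =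
      (B.card : ℂ)⁻¹ * ∑ p ∈ B ×ˢ B, chi (toIntIndex p.1 - toIntIndex p.2) t := by
  unfold fejerKernel
  push_cast
  congr 1
  rw [← Complex.mul_conj', map_sum, Finset.sum_mul_sum, ← Finset.sum_product']
  refine Finset.sum_congr rfl fun p _ => ?_
  rw [monomial_coord, monomial_coord, conj_chi, ← chi_add, sub_eq_add_neg]

theorem integral_fejerKernel {B : Finset (ℕ →₀ ℕ)} (hB : B.Nonempty) :
    ∫ t, fejerKernel B t ∂torusMeasure = 1 := by
  have h : ((∫ t, fejerKernel B t ∂torusMeasure : ℝ) : ℂ) = 1 := by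
    rw [← integral_complex_ofReal]
    simp_rw [ofReal_fejerKernel]
    rw [integral_const_mul, integral_finsetSum _ fun _ _ =>
      integrable_of_continuous (continuous_chi _)]
    simp_rw [integral_chi, sub_eq_zero, toIntIndex_injective.eq_iff]
    rw [Finset.sum_product]
    simp only [Finset.sum_ite_eq]
    rw [Finset.sum_congr rfl fun x hx => if_pos hx]
    have : (B.card : ℂ) ≠ 0 := Nat.cast_ne_zero.2 hB.card_pos.ne'
    simp [this]
  exact_mod_cast h

/-- Convolving with the Fejér-type kernel turns a function whose Fourier coefficients vanish off
the nonnegative multi-indices into an analytic polynomial. -/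
theorem integral_fejerKernel_smul [CompleteSpace X] {f : InfTorus → X}
    (hf : Integrable f torusMeasure)
    (hH : ∀ α : ℕ →₀ ℤ, (∃ j, α j < 0) → torusFourierCoeff f α = 0)
    (B S : Finset (ℕ →₀ ℕ)) (hS : ∀ p ∈ B ×ˢ B, p.1 - p.2 ∈ S) (t : InfTorus) :
    ∫ s, (fejerKernel B (t - s) : ℂ) • f s ∂torusMeasure =
      torusPoly S (fun α => fejerCoeff B α • torusFourierCoeff f (toIntIndex α)) t := by
  have hterm : ∀ δ : ℕ →₀ ℤ, Integrable (fun s => chi δ (t - s) • f s) torusMeasure := by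
    intro δ
    have hc : Continuous fun s => chi δ (t - s) := by fun_prop
    refine hf.bdd_smul 1 hc.aestronglyMeasurable ?_
    exact .of_forall fun s => (norm_chi _ _).le
  have hval : ∀ δ : ℕ →₀ ℤ, ∫ s, chi δ (t - s) • f s ∂torusMeasure
      = chi δ t • torusFourierCoeff f δ := by
    intro δ
    simp_rw [chi_apply_sub, mul_smul]
    rw [integral_smul]
    rfl
  simp_rw [ofReal_fejerKernel, mul_smul, Finset.sum_smul]
  rw [integral_smul, integral_finsetSum _ fun p _ => hterm _]
  simp_rw [hval]
  have hz : ∀ p ∈ B ×ˢ B, ¬ p.2 ≤ p.1 →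
      chi (toIntIndex p.1 - toIntIndex p.2) t
        • torusFourierCoeff f (toIntIndex p.1 - toIntIndex p.2) = 0 := by
    intro p _ hp
    rw [hH _ ?_, smul_zero]
    obtain ⟨j, hj⟩ := not_forall.1 hp
    exact ⟨j, by simp only [Finsupp.sub_apply, toIntIndex_apply]; omega⟩
  rw [← Finset.sum_filter_of_ne (p := fun p => p.2 ≤ p.1)
    fun p hp hne => by_contra fun h => hne (hz p hp h)]
  rw [← Finset.sum_fiberwise_of_maps_to (g := fun p : (ℕ →₀ ℕ) × (ℕ →₀ ℕ) => p.1 - p.2)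
    (t := S) fun p hp => hS p (Finset.mem_filter.1 hp).1, torusPoly, Finset.smul_sum]
  refine Finset.sum_congr rfl fun α _ => ?_
  rw [Finset.sum_congr rfl (g := fun _ => monomial (coord t) α • torusFourierCoeff f (toIntIndex α))]
  · rw [Finset.sum_const, Finset.filter_filter, fejerCoeff, smul_comm (monomial (coord t) α),
      ← Nat.cast_smul_eq_nsmul ℝ, mul_smul, ← Complex.coe_smul (B.card : ℝ)⁻¹]
    push_cast
    rfl
  · intro p hp
    simp only [Finset.mem_filter] at hp
    have : toIntIndex p.1 - toIntIndex p.2 = toIntIndex α := by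
      rw [← hp.2, sub_eq_iff_eq_add, ← toIntIndex_add, tsub_add_cancel_of_le hp.1.2]
    rw [this, monomial_coord]

/-- Convolution with the Fejér-type kernel does not increase the `L_1` norm, as the kernel is
nonnegative with integral `1`. -/
theorem integral_norm_fejer_le [CompleteSpace X] {f : InfTorus → X}
    (hf : Integrable f torusMeasure)
    (hH : ∀ α : ℕ →₀ ℤ, (∃ j, α j < 0) → torusFourierCoeff f α = 0)
    {B S : Finset (ℕ →₀ ℕ)} (hB : B.Nonempty) (hS : ∀ p ∈ B ×ˢ B, p.1 - p.2 ∈ S) :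
    ∫ t, ‖torusPoly S (fun α => fejerCoeff B α • torusFourierCoeff f (toIntIndex α)) t‖
        ∂torusMeasure ≤ ∫ t, ‖f t‖ ∂torusMeasure := by
  obtain ⟨M, hM⟩ := isCompact_univ.exists_bound_of_continuousOn
    (continuous_fejerKernel B).continuousOn
  have hint : Integrable (fun p : InfTorus × InfTorus => fejerKernel B (p.1 - p.2) * ‖f p.2‖)
      (torusMeasure.prod torusMeasure) := by
    refine (hf.norm.comp_snd torusMeasure).bdd_mul (c := M)
      (by fun_prop : Continuous _).aestronglyMeasurable ?_
    exact .of_forall fun p => hM _ (Set.mem_univ _)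
  calc _ ≤ ∫ t, ∫ s, fejerKernel B (t - s) * ‖f s‖ ∂torusMeasure ∂torusMeasure := by
        refine integral_mono (integrable_of_continuous (by fun_prop)) hint.integral_prod_left
          fun t => ?_
        simp only
        rw [← integral_fejerKernel_smul hf hH B S hS]
        refine (norm_integral_le_integral_norm _).trans_eq ?_
        simp_rw [norm_smul, Complex.norm_real, Real.norm_of_nonneg (fejerKernel_nonneg B _)]
    _ = ∫ s, ∫ t, fejerKernel B (t - s) * ‖f s‖ ∂torusMeasure ∂torusMeasure :=
        integral_integral_swap hint
    _ = ∫ t, ‖f t‖ ∂torusMeasure := by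
        simp_rw [integral_mul_const, integral_sub_right_eq_self (fejerKernel B),
          integral_fejerKernel hB, one_mul]

/-- The box of exponents `β` supported in `{0, …, N - 1}` with all entries at most `n`. -/
def expBox (N n : ℕ) : Finset (ℕ →₀ ℕ) :=
  Finset.Icc 0 (∑ j ∈ Finset.range N, Finsupp.single j n)

theorem sum_single_apply (N n i : ℕ) :
    (∑ j ∈ Finset.range N, Finsupp.single j n : ℕ →₀ ℕ) i = if i < N then n else 0 := by
  simp [Finsupp.finsetSum_apply, Finsupp.single_apply]

theorem card_Icc_zero {N : ℕ} (b : ℕ →₀ ℕ) (hb : b.support ⊆ Finset.range N) :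
    (Finset.Icc 0 b).card = ∏ j ∈ Finset.range N, (b j + 1) := by
  rw [Finsupp.card_Icc]
  simp only [Finsupp.support_zero, Finset.empty_union, Finsupp.coe_zero, Pi.zero_apply,
    Nat.card_Icc, tsub_zero]
  exact Finset.prod_subset hb fun j _ hj => by simpa using hj

theorem tendsto_fejerCoeff {N : ℕ} {α : ℕ →₀ ℕ} (hα : α.support ⊆ Finset.range N) :
    Tendsto (fun n => fejerCoeff (expBox N n) α) atTop (𝓝 1) := by
  have hbs : ∀ n, (∑ j ∈ Finset.range N, Finsupp.single j n : ℕ →₀ ℕ).support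
      ⊆ Finset.range N := by
    intro n j hj
    rw [Finsupp.mem_support_iff, sum_single_apply] at hj
    by_contra h
    exact hj (if_neg (by simpa using h))
  have hcard : ∀ n, (expBox N n).card = ∏ j ∈ Finset.range N, (n + 1) := by
    intro n
    rw [expBox, card_Icc_zero _ (hbs n)]
    refine Finset.prod_congr rfl fun j hj => ?_
    rw [sum_single_apply, if_pos (Finset.mem_range.1 hj)]
  have hlow : Tendsto (fun n : ℕ => ∏ j ∈ Finset.range N, (1 - (α j : ℝ) / (n + 1))) atTop
      (𝓝 1) := by
    have : Tendsto (fun n : ℕ => ∏ j ∈ Finset.range N, (1 - (α j : ℝ) / (n + 1))) atTop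
      (𝓝 (∏ j ∈ Finset.range N, (1 - 0))) := by
      refine tendsto_finsetProd _ fun j _ => tendsto_const_nhds.sub ?_
      exact tendsto_const_nhds.div_atTop
        (tendsto_atTop_add_const_right _ _ tendsto_natCast_atTop_atTop)
    simpa using this
  refine tendsto_of_tendsto_of_tendsto_of_le_of_le' hlow tendsto_const_nhds ?_ ?_
  · filter_upwards [eventually_ge_atTop α.degree] with n hn
    have hle : α ≤ ∑ j ∈ Finset.range N, Finsupp.single j n := by
      intro j
      rw [sum_single_apply]
      split_ifs with h
      · exact (Finsupp.le_degree j α).trans hn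
      · have : j ∉ α.support := fun hj => h (Finset.mem_range.1 (hα hj))
        simpa using this
    have hsub : (Finset.Icc 0 ((∑ j ∈ Finset.range N, Finsupp.single j n) - α)).card
        ≤ {p ∈ expBox N n ×ˢ expBox N n | p.2 ≤ p.1 ∧ p.1 - p.2 = α}.card := by
      refine Finset.card_le_card_of_injOn (fun β => (β + α, β)) ?_ ?_
      · intro β hβ
        have h1 := (Finset.mem_Icc.1 hβ).2
        have h2 := (le_tsub_iff_right hle).1 h1
        simp only [Finset.coe_filter, Finset.mem_product, Set.mem_ofPred_eq, expBox, Finset.mem_Icc,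
          zero_le, true_and, add_tsub_cancel_left]
        exact ⟨⟨h2, h1.trans tsub_le_self⟩, by simp⟩
      · intro β _ β' _ h
        exact (Prod.ext_iff.1 h).2
    have hc2 : (Finset.Icc 0 ((∑ j ∈ Finset.range N, Finsupp.single j n) - α)).card
        = ∏ j ∈ Finset.range N, (n - α j + 1) := by
      rw [card_Icc_zero (N := N) _ ?_]
      · refine Finset.prod_congr rfl fun j hj => ?_
        rw [Finsupp.tsub_apply, sum_single_apply, if_pos (Finset.mem_range.1 hj)]
      · refine (Finsupp.support_mono tsub_le_self).trans (hbs n)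
    rw [fejerCoeff, hcard, inv_mul_eq_div]
    calc ∏ j ∈ Finset.range N, (1 - (α j : ℝ) / (n + 1))
        = ((∏ j ∈ Finset.range N, (n - α j + 1) : ℕ) : ℝ)
          / ((∏ j ∈ Finset.range N, (n + 1) : ℕ) : ℝ) := by
          push_cast
          rw [← Finset.prod_div_distrib]
          refine Finset.prod_congr rfl fun j _ => ?_
          rw [Nat.cast_sub ((Finsupp.le_degree j α).trans hn)]
          have : (n : ℝ) + 1 ≠ 0 := by positivity
          field_simp
          ring
      _ ≤ _ := by
          rw [← hc2]
          gcongr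
  · refine .of_forall fun n => ?_
    rw [fejerCoeff, inv_mul_eq_div]
    refine div_le_one_of_le₀ ?_ (Nat.cast_nonneg _)
    refine Nat.cast_le.2 (Finset.card_le_card_of_injOn Prod.snd ?_ ?_)
    · intro p hp
      simp only [Finset.coe_filter, Finset.mem_product, Set.mem_ofPred_eq] at hp
      exact hp.1.2
    · intro p hp p' hp' h
      simp only [Finset.coe_filter, Finset.mem_product, Set.mem_ofPred_eq] at hp hp'
      refine Prod.ext ?_ h
      rw [← tsub_add_cancel_of_le hp.2.1, ← tsub_add_cancel_of_le hp'.2.1, hp.2.2, hp'.2.2, h]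

/-- An inequality for the coefficients of analytic polynomials passes to functions in `H_1`. -/
theorem sum_norm_fourierCoeff_le [CompleteSpace X] {z : ℕ → ℂ} {K : ℝ} (hK0 : 0 ≤ K)
    (hK : ∀ (S : Finset (ℕ →₀ ℕ)) (x : (ℕ →₀ ℕ) → X),
      ∑ α ∈ S, ‖monomial z α • x α‖ ≤ K * ∫ t, ‖torusPoly S x t‖ ∂torusMeasure)
    {f : InfTorus → X} (hf : Integrable f torusMeasure)
    (hH : ∀ α : ℕ →₀ ℤ, (∃ j, α j < 0) → torusFourierCoeff f α = 0) (A : Finset (ℕ →₀ ℕ)) :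
    ∑ α ∈ A, ‖monomial z α • torusFourierCoeff f (toIntIndex α)‖
      ≤ K * ∫ t, ‖f t‖ ∂torusMeasure := by
  classical
  obtain ⟨N, hN⟩ := exists_support_subset_range A
  have hlim : Tendsto (fun n => ∑ α ∈ A, fejerCoeff (expBox N n) α *
      ‖monomial z α • torusFourierCoeff f (toIntIndex α)‖) atTop
      (𝓝 (∑ α ∈ A, 1 * ‖monomial z α • torusFourierCoeff f (toIntIndex α)‖)) :=
    tendsto_finsetSum _ fun α hα => (tendsto_fejerCoeff (hN α hα)).mul_const _
  simp only [one_mul] at hlim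
  refine le_of_tendsto hlim (.of_forall fun n => ?_)
  set B := expBox N n with hB
  have hBne : B.Nonempty := ⟨0, by simp [hB, expBox]⟩
  set S := A ∪ (B ×ˢ B).image fun p => p.1 - p.2 with hS
  have hle := integral_norm_fejer_le hf hH hBne (S := S)
    fun p hp => Finset.mem_union_right _ (Finset.mem_image_of_mem _ hp)
  refine le_trans ?_ ((hK S _).trans (mul_le_mul_of_nonneg_left hle hK0))
  have hAS : A ⊆ S := Finset.subset_union_left
  refine (Finset.sum_le_sum_of_subset_of_nonneg hAS fun α _ _ =>
    mul_nonneg (fejerCoeff_nonneg _ _) (norm_nonneg _)).trans_eq ?_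
  refine Finset.sum_congr rfl fun α _ => ?_
  rw [smul_comm, norm_smul (fejerCoeff B α), Real.norm_of_nonneg (fejerCoeff_nonneg _ _)]

/-! ### Coefficient estimates -/

/-- Hölder's inequality for finite families. -/
theorem sum_norm_mul_norm_le {X ι : Type*} [NormedAddCommGroup X] [Fintype ι] {q q' : ℝ≥0∞} (hqq' : q⁻¹ + q'⁻¹ = 1)
    (a : ι → X) (b : ι → ℂ) :
    ∑ i, ‖a i‖ * ‖b i‖ ≤ ‖(WithLp.toLp q a : PiLp q fun _ : ι => X)‖ *
      ‖(WithLp.toLp q' b : PiLp q' fun _ : ι => ℂ)‖ := by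
  rcases eq_or_ne q ⊤ with rfl | hq
  · have hq' : q' = 1 := by simpa using hqq'
    subst hq'
    rw [PiLp.norm_eq_sum (p := 1) (by simp), PiLp.norm_eq_ciSup, ENNReal.toReal_one]
    simp only [Real.rpow_one, div_one]
    rw [Finset.mul_sum]
    exact Finset.sum_le_sum fun i _ => mul_le_mul_of_nonneg_right
      (le_ciSup (f := fun i => ‖a i‖) (Set.finite_range _).bddAbove i) (norm_nonneg _)
  rcases eq_or_ne q' ⊤ with rfl | hq'
  · have hq : q = 1 := by simpa using hqq'
    subst hq
    rw [PiLp.norm_eq_sum (p := 1) (by simp), PiLp.norm_eq_ciSup, ENNReal.toReal_one]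
    simp only [Real.rpow_one, div_one]
    rw [Finset.sum_mul]
    exact Finset.sum_le_sum fun i _ => mul_le_mul_of_nonneg_left
      (le_ciSup (f := fun i => ‖b i‖) (Set.finite_range _).bddAbove i) (norm_nonneg _)
  have hq0 : q ≠ 0 := by rintro rfl; simp at hqq'
  have hq0' : q' ≠ 0 := by rintro rfl; simp at hqq'
  have hp : 0 < q.toReal := ENNReal.toReal_pos hq0 hq
  have hp' : 0 < q'.toReal := ENNReal.toReal_pos hq0' hq'
  have hconj : q.toReal.HolderConjugate q'.toReal := by
    refine Real.holderConjugate_iff.2 ?_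
    have h := congrArg ENNReal.toReal hqq'
    rw [ENNReal.toReal_add (by simpa using hq0) (by simpa using hq0'), ENNReal.toReal_inv,
      ENNReal.toReal_inv, ENNReal.toReal_one] at h
    refine ⟨?_, h⟩
    have : 0 < q'.toReal⁻¹ := inv_pos.2 hp'
    exact (inv_lt_one₀ hp).1 (by linarith)
  rw [PiLp.norm_eq_sum hp, PiLp.norm_eq_sum hp']
  exact Real.inner_le_Lp_mul_Lq_of_nonneg _ hconj (fun i _ => norm_nonneg _)
    fun i _ => norm_nonneg _

/-- Bound for a sum of distinct `m`-homogeneous monomials by a power of a sum, discarding the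
multinomial coefficients. -/
theorem sum_prod_pow_le_pow_sum {m : ℕ} {S : Finset (ℕ →₀ ℕ)} (hS : ∀ α ∈ S, α.degree = m)
    {J : Finset ℕ} (hJ : ∀ α ∈ S, α.support ⊆ J) {b : ℕ → ℝ} (hb : ∀ j, 0 ≤ b j) :
    ∑ α ∈ S, ∏ j ∈ J, b j ^ α j ≤ (∑ j ∈ J, b j) ^ m := by
  classical
  rw [Finset.sum_pow_eq_sum_piAntidiag]
  have hinj : Set.InjOn (fun (α : ℕ →₀ ℕ) (j : ℕ) => α j) S :=
    fun α _ β _ h => DFunLike.coe_injective h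
  have hsub : S.image (fun (α : ℕ →₀ ℕ) (j : ℕ) => α j) ⊆ J.piAntidiag m := by
    intro v hv
    obtain ⟨α, hα, rfl⟩ := Finset.mem_image.1 hv
    rw [Finset.mem_piAntidiag]
    refine ⟨?_, fun i hi => hJ α hα (Finsupp.mem_support_iff.2 hi)⟩
    rw [← hS α hα, Finsupp.degree_apply]
    exact (Finset.sum_subset (hJ α hα) fun j _ hj => by simpa using hj).symm
  have hnn : ∀ v : ℕ → ℕ, 0 ≤ ∏ j ∈ J, b j ^ v j :=
    fun v => Finset.prod_nonneg fun j _ => pow_nonneg (hb j) _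
  calc ∑ α ∈ S, ∏ j ∈ J, b j ^ α j
      = ∑ v ∈ S.image (fun (α : ℕ →₀ ℕ) (j : ℕ) => α j), ∏ j ∈ J, b j ^ v j := by
        rw [Finset.sum_image hinj]
    _ ≤ ∑ v ∈ J.piAntidiag m, ∏ j ∈ J, b j ^ v j :=
        Finset.sum_le_sum_of_subset_of_nonneg hsub fun v _ _ => hnn v
    _ ≤ ∑ v ∈ J.piAntidiag m, (Nat.multinomial J v : ℝ) * ∏ j ∈ J, b j ^ v j := by
        refine Finset.sum_le_sum fun v _ => le_mul_of_one_le_left (hnn v) ?_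
        exact_mod_cast Nat.multinomial_pos J v

theorem norm_monomial_eq_prod {α : ℕ →₀ ℕ} {J : Finset ℕ} (hJ : α.support ⊆ J) (z : ℕ → ℂ) :
    ‖monomial z α‖ = ∏ j ∈ J, ‖z j‖ ^ α j := by
  rw [monomial, Finsupp.prod_of_support_subset _ hJ _ (by simp), norm_prod]
  simp_rw [norm_pow]

/-- If `z ∈ ℓ_p` tends to zero, then the `ℓ_p` norm of any family of distinct `m`-homogeneous
monomials in the variables `z_k, z_{k+1}, …` is at most `ε ^ m` for large `k`. -/
theorem exists_norm_toLp_monomial_le {p : ℝ≥0∞} (hp0 : p ≠ 0) {z : ℕ → ℂ} (hz : Memℓp z p)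
    (hz0 : Tendsto z atTop (𝓝 0)) {ε : ℝ} (hε : 0 < ε) :
    ∃ k : ℕ, ∀ (m : ℕ) (S : Finset (ℕ →₀ ℕ)), (∀ α ∈ S, α.degree = m) →
      (∀ α ∈ S, ∀ j < k, α j = 0) →
      ‖(WithLp.toLp p fun α : S => monomial z α : PiLp p fun _ : S => ℂ)‖ ≤ ε ^ m := by
  rcases eq_or_ne p ⊤ with rfl | hp
  · obtain ⟨k, hk⟩ := Filter.eventually_atTop.1
      ((tendsto_zero_iff_norm_tendsto_zero.1 hz0).eventually (ge_mem_nhds hε))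
    refine ⟨k, fun m S hm hS => ?_⟩
    rw [PiLp.norm_eq_ciSup]
    refine Real.iSup_le (fun α => ?_) (by positivity)
    simp only
    rw [norm_monomial_eq_prod subset_rfl, ← hm α α.2, Finsupp.degree_apply,
      ← Finset.prod_pow_eq_pow_sum]
    refine Finset.prod_le_prod (fun j _ => by positivity) fun j hj => ?_
    refine pow_le_pow_left₀ (norm_nonneg _) (hk j ?_) _
    by_contra h
    exact Finsupp.mem_support_iff.1 hj (hS α α.2 j (not_le.1 h))
  · have hp' : 0 < p.toReal := ENNReal.toReal_pos hp0 hp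
    have hsum : Summable fun j => ‖z j‖ ^ p.toReal := hz.summable hp'
    obtain ⟨s, hs⟩ := summable_iff_vanishing_norm.1 hsum (ε ^ p.toReal) (by positivity)
    refine ⟨s.sup id + 1, fun m S hm hS => ?_⟩
    classical
    set J := S.biUnion fun α => α.support with hJ
    have hJS : ∀ α ∈ S, α.support ⊆ J := fun α hα =>
      Finset.subset_biUnion_of_mem (fun α : ℕ →₀ ℕ => α.support) hα
    have hdis : Disjoint J s := by
      rw [Finset.disjoint_left]
      intro j hj hjs
      obtain ⟨α, hα, hjα⟩ := Finset.mem_biUnion.1 hj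
      exact Finsupp.mem_support_iff.1 hjα
        (hS α hα j (Nat.lt_succ_of_le (Finset.le_sup (f := id) hjs)))
    have hJε : ∑ j ∈ J, ‖z j‖ ^ p.toReal ≤ ε ^ p.toReal :=
      (Real.le_norm_self _).trans (hs J hdis).le
    rw [PiLp.norm_eq_sum hp']
    simp only
    rw [Finset.sum_coe_sort S fun α => ‖monomial z α‖ ^ p.toReal, one_div,
      Real.rpow_inv_le_iff_of_pos (Finset.sum_nonneg fun _ _ => by positivity) (by positivity) hp']
    calc ∑ α ∈ S, ‖monomial z α‖ ^ p.toReal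
        = ∑ α ∈ S, ∏ j ∈ J, (‖z j‖ ^ p.toReal) ^ α j := by
          refine Finset.sum_congr rfl fun α hα => ?_
          rw [norm_monomial_eq_prod (hJS α hα), ← Real.finsetProd_rpow _ _ fun j _ => by positivity]
          refine Finset.prod_congr rfl fun j _ => ?_
          rw [← Real.rpow_natCast, ← Real.rpow_natCast, ← Real.rpow_mul (norm_nonneg _),
            ← Real.rpow_mul (norm_nonneg _), mul_comm]
      _ ≤ (∑ j ∈ J, ‖z j‖ ^ p.toReal) ^ m :=
          sum_prod_pow_le_pow_sum hm hJS fun j => by positivity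
      _ ≤ (ε ^ p.toReal) ^ m := by
          refine pow_le_pow_left₀ (Finset.sum_nonneg fun _ _ => by positivity) hJε _
      _ = (ε ^ m) ^ p.toReal := by
          rw [← Real.rpow_natCast, ← Real.rpow_natCast, ← Real.rpow_mul hε.le,
            ← Real.rpow_mul hε.le, mul_comm]

/-- Partial sums of the multivariate geometric series. -/
theorem sum_prod_pow_le_prod_inv {J : Finset ℕ} {G : Finset (ℕ →₀ ℕ)}
    (hG : ∀ γ ∈ G, γ.support ⊆ J) {w : ℕ → ℝ} (hw0 : ∀ j, 0 ≤ w j) (hw1 : ∀ j, w j < 1) :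
    ∑ γ ∈ G, ∏ j ∈ J, w j ^ γ j ≤ ∏ j ∈ J, (1 - w j)⁻¹ := by
  classical
  set D := (G.sup fun γ => γ.degree) + 1 with hD
  let e : (ℕ →₀ ℕ) → ∀ j ∈ J, ℕ := fun γ j _ => γ j
  have hinj : Set.InjOn e G := by
    intro γ hγ γ' hγ' h
    ext j
    by_cases hj : j ∈ J
    · exact congrFun (congrFun h j) hj
    · have h1 : j ∉ γ.support := fun h => hj (hG γ hγ h)
      have h2 : j ∉ γ'.support := fun h => hj (hG γ' hγ' h)
      rw [Finsupp.notMem_support_iff.1 h1, Finsupp.notMem_support_iff.1 h2]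
  have hsub : G.image e ⊆ J.pi fun _ => Finset.range D := by
    intro v hv
    obtain ⟨γ, hγ, rfl⟩ := Finset.mem_image.1 hv
    refine Finset.mem_pi.2 fun j _ => Finset.mem_range.2 (Nat.lt_succ_of_le ?_)
    exact (Finsupp.le_degree j γ).trans (Finset.le_sup (f := fun γ : ℕ →₀ ℕ => γ.degree) hγ)
  calc ∑ γ ∈ G, ∏ j ∈ J, w j ^ γ j
      = ∑ v ∈ G.image e, ∏ j ∈ J.attach, w j ^ v j j.2 := by
        rw [Finset.sum_image hinj]
        exact Finset.sum_congr rfl fun γ _ =>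
          (Finset.prod_attach J fun j => w j ^ γ j).symm
    _ ≤ ∑ v ∈ J.pi fun _ => Finset.range D, ∏ j ∈ J.attach, w j ^ v j j.2 :=
        Finset.sum_le_sum_of_subset_of_nonneg hsub fun v _ _ =>
          Finset.prod_nonneg fun j _ => pow_nonneg (hw0 _) _
    _ = ∏ j ∈ J, ∑ n ∈ Finset.range D, w j ^ n :=
        (Finset.prod_sum J (fun _ => Finset.range D) fun j n => w j ^ n).symm
    _ ≤ ∏ j ∈ J, (1 - w j)⁻¹ := by
        refine Finset.prod_le_prod (fun j _ => Finset.sum_nonneg fun n _ => pow_nonneg (hw0 j) _)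
          fun j _ => ?_
        rw [← tsum_geometric_of_lt_one (hw0 j) (hw1 j)]
        exact (summable_geometric_of_lt_one (hw0 j) (hw1 j)).sum_le_tsum _
          fun n _ => pow_nonneg (hw0 j) _

/-- Gluing together the variables from the `k`-th on replaces the corresponding exponents by their
sum. -/
theorem mapDomain_min_eq (k : ℕ) (α : ℕ →₀ ℕ) :
    α.mapDomain (min · k) =
      α.filter (· < k) + Finsupp.single k (α.filter fun j => ¬ j < k).degree := by
  conv_lhs => rw [← Finsupp.filter_add_filter_not α (· < k)]
  rw [Finsupp.mapDomain_add]
  congr 1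
  · rw [Finsupp.mapDomain_congr (g := id), Finsupp.mapDomain_id]
    intro j hj
    have := (Finsupp.mem_support_iff.1 hj)
    have : j < k := by
      by_contra h
      exact this (Finsupp.filter_apply_neg _ _ h)
    simp [this.le]
  · rw [Finsupp.mapDomain_congr (g := fun _ => k)]
    · rw [Finsupp.mapDomain, Finsupp.sum, Finsupp.degree_apply]
      exact (map_sum (Finsupp.singleAddHom k) _ _).symm
    · intro j hj
      have := (Finsupp.mem_support_iff.1 hj)
      have : ¬ j < k := by
        intro h
        exact this (Finsupp.filter_apply_neg _ _ (not_not.2 h))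
      simpa using this

theorem mapDomain_min_apply_of_lt {k j : ℕ} (hj : j < k) (α : ℕ →₀ ℕ) :
    α.mapDomain (min · k) j = α j := by
  rw [mapDomain_min_eq, Finsupp.add_apply, Finsupp.filter_apply, if_pos hj,
    Finsupp.single_eq_of_ne hj.ne, add_zero]

theorem mapDomain_min_apply_self (k : ℕ) (α : ℕ →₀ ℕ) :
    α.mapDomain (min · k) k = (α.filter fun j => ¬ j < k).degree := by
  rw [mapDomain_min_eq, Finsupp.add_apply, Finsupp.filter_apply, if_neg (lt_irrefl k),
    Finsupp.single_eq_same, zero_add]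

theorem filter_lt_of_mapDomain_min_eq {k : ℕ} {α γ : ℕ →₀ ℕ} (h : α.mapDomain (min · k) = γ) :
    α.filter (· < k) = γ.filter (· < k) := by
  ext j
  by_cases hj : j < k
  · rw [Finsupp.filter_apply, Finsupp.filter_apply, if_pos hj, if_pos hj, ← h,
      mapDomain_min_apply_of_lt hj]
  · rw [Finsupp.filter_apply, Finsupp.filter_apply, if_neg hj, if_neg hj]

theorem support_mapDomain_min_subset (k : ℕ) (α : ℕ →₀ ℕ) :
    (α.mapDomain (min · k)).support ⊆ Finset.range (k + 1) := by
  classical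
  intro j hj
  obtain ⟨i, _, rfl⟩ := Finset.mem_image.1 (Finsupp.mapDomain_support hj)
  exact Finset.mem_range.2 (Nat.lt_succ_of_le (min_le_right _ _))

theorem monomial_add (z : ℕ → ℂ) (α β : ℕ →₀ ℕ) :
    monomial z (α + β) = monomial z α * monomial z β :=
  Finsupp.prod_add_index' (by simp) fun _ _ _ => pow_add _ _ _

/-- If hypercontractive cotype holds with constant `C` and the `ℓ_{q'}` norms of the families of
`m`-homogeneous monomials in the variables beyond the `k`-th are at most `(50 C) ^ (-m)`, then
`m`-homogeneous polynomials in these variables satisfy the estimate with factor `2 ^ (-m)`. -/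
theorem sum_norm_monomial_smul_le_of_homogeneous [CompleteSpace X] {q q' : ℝ≥0∞}
    (hqq' : q⁻¹ + q'⁻¹ = 1) {C : ℝ} (hC : 0 < C)
    (hX : ∀ m : ℕ, 1 ≤ m → ∀ S : Finset (ℕ →₀ ℕ), (∀ α ∈ S, α.degree = m) →
      ∀ x : (ℕ →₀ ℕ) → X,
        ‖(WithLp.toLp q fun α : S => x α : PiLp q fun _ : S => X)‖ ≤
          C ^ m * (∫ t, ‖torusPoly S x t‖ ^ 2 ∂torusMeasure) ^ (1 / 2 : ℝ))
    {z : ℕ → ℂ} {m : ℕ} {S : Finset (ℕ →₀ ℕ)} (hS : ∀ α ∈ S, α.degree = m)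
    (hz : ‖(WithLp.toLp q' fun α : S => monomial z α : PiLp q' fun _ : S => ℂ)‖
      ≤ (1 / (50 * C)) ^ m) (x : (ℕ →₀ ℕ) → X) :
    ∑ α ∈ S, ‖monomial z α • x α‖ ≤ (1 / 2) ^ m * ∫ t, ‖torusPoly S x t‖ ∂torusMeasure := by
  rcases Nat.eq_zero_or_pos m with rfl | hm
  · -- the only multi-index of degree `0` is `0`, and both sides are `‖x 0‖` or `0`
    have hsub : S ⊆ {0} := fun α hα => Finset.mem_singleton.2
      ((Finsupp.degree_eq_zero_iff α).1 (hS α hα))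
    rcases Finset.subset_singleton_iff.1 hsub with rfl | rfl
    · simp [torusPoly]
    · simp [torusPoly, monomial]
  have : Fact (1 ≤ q') := ⟨ENNReal.inv_le_one.1 (hqq' ▸ le_add_self)⟩
  have ha0 : 0 ≤ ∫ t, ‖torusPoly S x t‖ ∂torusMeasure := integral_nonneg fun t => norm_nonneg _
  have hL2 : (∫ t, ‖torusPoly S x t‖ ^ 2 ∂torusMeasure) ^ (1 / 2 : ℝ)
      ≤ 25 ^ m * ∫ t, ‖torusPoly S x t‖ ∂torusMeasure := by
    rw [← Real.sqrt_eq_rpow]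
    exact Real.sqrt_le_iff.2 ⟨by positivity, integral_sq_norm_torusPoly_le hS x⟩
  have hx := (hX m hm S hS x).trans (mul_le_mul_of_nonneg_left hL2 (by positivity))
  calc ∑ α ∈ S, ‖monomial z α • x α‖
      = ∑ α : S, ‖x α‖ * ‖monomial z α‖ := by
        rw [Finset.sum_coe_sort S fun α => ‖x α‖ * ‖monomial z α‖]
        exact Finset.sum_congr rfl fun α _ => by rw [norm_smul, mul_comm]
    _ ≤ _ := sum_norm_mul_norm_le hqq' (fun α : S => x α) fun α : S => monomial z α
    _ ≤ (C ^ m * (25 ^ m * ∫ t, ‖torusPoly S x t‖ ∂torusMeasure)) * (1 / (50 * C)) ^ m :=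
        mul_le_mul hx hz (norm_nonneg _) (by positivity)
    _ = (C * 25 * (1 / (50 * C))) ^ m * ∫ t, ‖torusPoly S x t‖ ∂torusMeasure := by
        rw [mul_pow, mul_pow]; ring
    _ = _ := by
        congr 2
        field_simp
        norm_num

/-- The estimate for the block of a polynomial with prescribed exponents in the first `k`
variables and prescribed degree in the remaining ones. -/
theorem sum_filter_norm_monomial_smul_le [CompleteSpace X] {z : ℕ → ℂ} {k : ℕ}
    (hk : ∀ (m : ℕ) (S : Finset (ℕ →₀ ℕ)), (∀ α ∈ S, α.degree = m) →
      (∀ α ∈ S, ∀ j < k, α j = 0) → ∀ x : (ℕ →₀ ℕ) → X,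
      ∑ α ∈ S, ‖monomial z α • x α‖ ≤ (1 / 2) ^ m * ∫ t, ‖torusPoly S x t‖ ∂torusMeasure)
    (S : Finset (ℕ →₀ ℕ)) (x : (ℕ →₀ ℕ) → X) (γ : ℕ →₀ ℕ) :
    ∑ α ∈ S with α.mapDomain (min · k) = γ, ‖monomial z α • x α‖ ≤
      (∏ j ∈ Finset.range (k + 1), (if j < k then ‖z j‖ else 1 / 2) ^ γ j) *
        ∫ t, ‖torusPoly S x t‖ ∂torusMeasure := by
  classical
  set T := S.filter fun α => α.mapDomain (min · k) = γ with hT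
  set β := γ.filter (· < k) with hβ
  set tail : (ℕ →₀ ℕ) → (ℕ →₀ ℕ) := fun α => α.filter fun j => ¬ j < k with htail
  have hdec : ∀ α ∈ T, β + tail α = α := by
    intro α hα
    rw [hβ, ← filter_lt_of_mapDomain_min_eq (Finset.mem_filter.1 hα).2]
    exact Finsupp.filter_add_filter_not α _
  have hinj : Set.InjOn tail T := fun α hα α' hα' h => by
    rw [← hdec α hα, ← hdec α' hα', h]
  set y : (ℕ →₀ ℕ) → X := fun α => x (β + α) with hy
  have hnorm : ∀ t, ‖torusPoly T x t‖ = ‖torusPoly (T.image tail) y t‖ := by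
    intro t
    have : torusPoly T x t = monomial (coord t) β • torusPoly (T.image tail) y t := by
      rw [torusPoly, torusPoly, Finset.sum_image hinj, Finset.smul_sum]
      refine Finset.sum_congr rfl fun α hα => ?_
      simp only [hy]
      rw [smul_smul, ← monomial_add, hdec α hα]
    rw [this, norm_smul, norm_monomial_coord, one_mul]
  have hsum : ∑ α ∈ T, ‖monomial z α • x α‖
      = ‖monomial z β‖ * ∑ α ∈ T.image tail, ‖monomial z α • y α‖ := by
    rw [Finset.sum_image hinj, Finset.mul_sum]
    refine Finset.sum_congr rfl fun α hα => ?_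
    simp only [hy]
    rw [← norm_smul, smul_smul, ← monomial_add, hdec α hα]
  have hhom := hk (γ k) (T.image tail) (fun α hα => by
      obtain ⟨α', hα', rfl⟩ := Finset.mem_image.1 hα
      exact (mapDomain_min_apply_self k α').symm.trans
        (DFunLike.congr_fun (Finset.mem_filter.1 hα').2 k)) (fun α hα j hj => by
      obtain ⟨α, hα, rfl⟩ := Finset.mem_image.1 hα
      exact Finsupp.filter_apply_neg _ _ (not_not.2 hj)) y
  simp_rw [← hnorm] at hhom
  have hβn : ‖monomial z β‖ = ∏ j ∈ Finset.range k, ‖z j‖ ^ γ j := by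
    rw [norm_monomial_eq_prod (J := Finset.range k)]
    · refine Finset.prod_congr rfl fun j hj => ?_
      rw [hβ, Finsupp.filter_apply, if_pos (Finset.mem_range.1 hj)]
    · intro j hj
      by_contra h
      exact Finsupp.mem_support_iff.1 hj
        (Finsupp.filter_apply_neg _ _ fun h' => h (Finset.mem_range.2 h'))
  have hprod : ∏ j ∈ Finset.range (k + 1), (if j < k then ‖z j‖ else 1 / 2) ^ γ j
      = ‖monomial z β‖ * (1 / 2) ^ γ k := by
    rw [Finset.prod_range_succ, if_neg (lt_irrefl k), hβn]
    congr 1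
    exact Finset.prod_congr rfl fun j hj => by rw [if_pos (Finset.mem_range.1 hj)]
  rw [hsum, hprod, mul_assoc]
  refine mul_le_mul_of_nonneg_left (hhom.trans ?_) (norm_nonneg _)
  exact mul_le_mul_of_nonneg_left (integral_norm_torusPoly_filter_le k γ S x) (by positivity)

/-- The estimate for the coefficients of arbitrary analytic polynomials. -/
theorem exists_sum_norm_monomial_smul_le [CompleteSpace X] {q q' : ℝ≥0∞}
    (hqq' : q⁻¹ + q'⁻¹ = 1) (hX : HypercontractiveHomogeneousCotype X q) {z : ℕ → ℂ}
    (hz : z ∈ ellSet q' ∩ c0UnitBall) :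
    ∃ K : ℝ, 0 ≤ K ∧ ∀ (S : Finset (ℕ →₀ ℕ)) (x : (ℕ →₀ ℕ) → X),
      ∑ α ∈ S, ‖monomial z α • x α‖ ≤ K * ∫ t, ‖torusPoly S x t‖ ∂torusMeasure := by
  classical
  obtain ⟨C, hC, hX⟩ := hX
  obtain ⟨hzq, hz0, hz1⟩ := hz
  have hq0' : q' ≠ 0 := by rintro rfl; simp at hqq'
  have hz1' : ∀ j, ‖z j‖ < 1 := fun j =>
    (le_ciSup hz0.norm.bddAbove_range j).trans_lt hz1
  obtain ⟨k, hk⟩ := exists_norm_toLp_monomial_le hq0' hzq hz0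
    (ε := 1 / (50 * C)) (by positivity)
  set w : ℕ → ℝ := fun j => if j < k then ‖z j‖ else 1 / 2 with hw
  have hw0 : ∀ j, 0 ≤ w j := fun j => by simp only [hw]; split_ifs <;> positivity
  have hw1 : ∀ j, w j < 1 := fun j => by
    simp only [hw]; split_ifs
    exacts [hz1' j, by norm_num]
  refine ⟨∏ j ∈ Finset.range (k + 1), (1 - w j)⁻¹, Finset.prod_nonneg fun j _ =>
    inv_nonneg.2 (sub_nonneg.2 (hw1 j).le), fun S x => ?_⟩
  set G := S.image fun α => α.mapDomain (min · k) with hG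
  rw [← Finset.sum_fiberwise_of_maps_to (t := G) fun α hα => Finset.mem_image_of_mem _ hα]
  calc _ ≤ ∑ γ ∈ G, (∏ j ∈ Finset.range (k + 1), w j ^ γ j) *
        ∫ t, ‖torusPoly S x t‖ ∂torusMeasure :=
        Finset.sum_le_sum fun γ _ => sum_filter_norm_monomial_smul_le
          (fun m T hm hT y => sum_norm_monomial_smul_le_of_homogeneous hqq' hC hX hm
            (hk m T hm hT) y) S x γ
    _ ≤ _ := by
        rw [← Finset.sum_mul]
        refine mul_le_mul_of_nonneg_right (sum_prod_pow_le_prod_inv (fun γ hγ => ?_) hw0 hw1)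
          (integral_nonneg fun t => norm_nonneg _)
        obtain ⟨α, _, rfl⟩ := Finset.mem_image.1 hγ
        exact support_mapDomain_min_subset k α

end MonConv

end

theorem lemma3p4 (X : Type*) [NormedAddCommGroup X] [NormedSpace ℂ X] [CompleteSpace X]
    (q q' : ℝ≥0∞) (hqq' : q⁻¹ + q'⁻¹ = 1)
    (hX : MonConv.HypercontractiveHomogeneousCotype X q) :
    MonConv.ellSet q' ∩ MonConv.c0UnitBall ⊆ MonConv.monHardy X 1 := by
  intro z hz f hf
  obtain ⟨K, hK0, hK⟩ := MonConv.exists_sum_norm_monomial_smul_le hqq' hX hz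
  exact summable_of_sum_le (fun α => norm_nonneg _)
    (MonConv.sum_norm_fourierCoeff_le hK0 hK (L1.integrable_coeFn f) hf)
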